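/- Work over $\mathbb{Q}$, with differentials of degree $+1$. A commutative DGA is a graded-commutative unital differential graded algebra $A=\bigoplus_{i\ge 0}A^i$; it is connected if $H^0(A)=\mathbb{Q}\cdot 1\neq 0$ (for example, if $A^0=\mathbb{Q}$). Put $A^+=\bigoplus_{i>0}A^i$. For a differential graded Lie algebra (DGLA) $L$, the DGLA structure on $A\otimes L$ is $$[b_1\otimes w_1,b_2\otimes w_2]=(-1)^{|w_1||b_2|}(b_1b_2)\otimes[w_1,w_2],\qquad d(b\otimes w)=(db)\otimes w+(-1)^{|b|}b\otimes dw,$$ and $F(\alpha)=d\alpha+\tfrac12[\alpha,\alpha]$ for $\alpha$ of degree $1$; $\alpha$ is a Maurer–Cartan element if $F(\alpha)=0$. An MC-product data $\lambda$ consists of a central extension $0\to Z\to\widetilde L\xrightarrow{\pi}L\to 0$ of nilpotent DGLAs concentrated in nonpositive degrees, such that $Z\subset\ker \tilde d_L$ and $\operatorname{im}\tilde d_L\cap Z=0$, where $\tilde d_L$ is the differential of $\widetilde L$, together with an isomorphism of graded vector spaces between $Z$ and a copy of $\mathbb{Q}$ placed in some degree $q\le 0$; let $z\in Z$ correspond to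 $1$. A defining system in $A$ is a Maurer–Cartan element $\alpha\in(A^+\otimes L)^1$. If $\tilde\alpha\in(A^+\otimes\widetilde L)^1$ is a lift of $\alpha$, then $F(\tilde\alpha)=c\otimes z$ for a cocycle $c\in A^+$, and the class $m(\alpha)=[c]\in H^{2-q}(A)$ does not depend on the lift. Let $MP_\lambda(A)\subset H^\bullet(A)$ be the set of the classes $m(\alpha)$, where $\alpha$ runs through all defining systems in $A$. **Proposition.** Let $f\colon A\to B$ be a quasi-isomorphism of connected commutative DGAs. Then for every MC-product data $\lambda$ the induced map $f_*\colon H^\bullet(A)\to H^\bullet(B)$ restricts to a bijection $MP_\lambda(A)\to MP_\lambda(B)$. -/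

import Mathlib

open scoped TensorProduct DirectSum

universe u v w t

noncomputable section

/-- For a `ℤ`-graded rational vector space `M = ⨁ M^j` and `k : ℤ`, the linear map which multiplies
`M^j` by the Koszul sign `(-1)^(k * j)`. -/
def signTwist {M : Type u} [AddCommGroup M] [Module ℚ M] (gr : ℤ → Submodule ℚ M)
    [DirectSum.Decomposition gr] (k : ℤ) : M →ₗ[ℚ] M :=
  (DirectSum.toModule ℚ ℤ M fun j => ((-1 : ℚ) ^ (k * j)) • (gr j).subtype) ∘ₗ
    (DirectSum.decomposeLinearEquiv gr).toLinearMap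

theorem signTwist_apply {M : Type u} [AddCommGroup M] [Module ℚ M] (gr : ℤ → Submodule ℚ M)
    [DirectSum.Decomposition gr] (k j : ℤ) {x : M} (hx : x ∈ gr j) :
    signTwist gr k x = ((-1 : ℚ) ^ (k * j)) • x := by
  simp only [signTwist, LinearMap.comp_apply, LinearEquiv.coe_coe,
    DirectSum.decomposeLinearEquiv_apply]
  rw [DirectSum.decompose_of_mem gr hx]
  exact (DirectSum.toModule_lof (R := ℚ) (M := fun i => gr i) j ⟨x, hx⟩).trans (by simp)

/-! ### Commutative differential graded algebras -/

/-- A (graded-)commutative unital differential graded algebra `A = ⨁_{i ≥ 0} A^i` over `ℚ`, with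
differential of degree `+1`. The grading is indexed by `ℤ`, with `A^i = 0` for `i < 0`. -/
structure CommDGA where
  carrier : Type u
  [ring : Ring carrier]
  [algebra : Algebra ℚ carrier]
  gr : ℤ → Submodule ℚ carrier
  [graded : GradedAlgebra gr]
  gr_neg : ∀ i : ℤ, i < 0 → gr i = ⊥
  mul_comm_graded : ∀ (i j : ℤ) (a b : carrier), a ∈ gr i → b ∈ gr j →
    a * b = ((-1 : ℚ) ^ (i * j)) • (b * a)
  d : carrier →ₗ[ℚ] carrier
  d_mem : ∀ (i : ℤ) (a : carrier), a ∈ gr i → d a ∈ gr (i + 1)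
  d_d : ∀ a : carrier, d (d a) = 0
  leibniz : ∀ (i : ℤ) (a b : carrier), a ∈ gr i →
    d (a * b) = d a * b + ((-1 : ℚ) ^ i) • (a * d b)

attribute [instance] CommDGA.ring CommDGA.algebra CommDGA.graded

namespace CommDGA

instance : CoeSort CommDGA.{u} (Type u) := ⟨CommDGA.carrier⟩

/-- The boundaries, as a subspace of the cocycles. -/
def boundaries (A : CommDGA.{u}) : Submodule ℚ (LinearMap.ker A.d) :=
  (LinearMap.range A.d).comap (LinearMap.ker A.d).subtype

/-- The (total) cohomology `H^•(A) = ker d / im d`. -/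
abbrev Cohomology (A : CommDGA.{u}) : Type u := LinearMap.ker A.d ⧸ A.boundaries

/-- The cohomology class of a cocycle. -/
def cls (A : CommDGA.{u}) (c : A) (hc : A.d c = 0) : A.Cohomology :=
  A.boundaries.mkQ ⟨c, LinearMap.mem_ker.2 hc⟩

/-- `A` is connected: `ℚ → H^0(A)`, `r ↦ r · 1`, is an isomorphism. As `A` lives in degrees `≥ 0`,
`H^0(A)` is the space of cocycles of degree `0`. -/
def IsConnected (A : CommDGA.{u}) : Prop :=
  Nontrivial A ∧ ∀ a ∈ A.gr 0, A.d a = 0 → ∃ r : ℚ, algebraMap ℚ A r = a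

/-- Morphisms of commutative DGAs. -/
structure Hom (A : CommDGA.{u}) (B : CommDGA.{v}) where
  toAlgHom : A →ₐ[ℚ] B
  map_gr : ∀ (i : ℤ) (a : A), a ∈ A.gr i → toAlgHom a ∈ B.gr i
  map_d : ∀ a : A, toAlgHom (A.d a) = B.d (toAlgHom a)

/-- The map induced by a morphism on cocycles. -/
def Hom.mapCocycles {A : CommDGA.{u}} {B : CommDGA.{v}} (f : Hom A B) :
    LinearMap.ker A.d →ₗ[ℚ] LinearMap.ker B.d :=
  f.toAlgHom.toLinearMap.restrict fun a ha => by
    rw [LinearMap.mem_ker] at ha ⊢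
    rw [AlgHom.toLinearMap_apply, ← f.map_d, ha, map_zero]

/-- The map `H^•(A) → H^•(B)` induced by a morphism. -/
def Hom.mapCohomology {A : CommDGA.{u}} {B : CommDGA.{v}} (f : Hom A B) :
    A.Cohomology →ₗ[ℚ] B.Cohomology :=
  A.boundaries.mapQ B.boundaries f.mapCocycles (by
    rintro ⟨a, ha⟩ ⟨b, hb⟩
    exact ⟨f.toAlgHom b, by rw [← f.map_d, hb]; rfl⟩)

/-- `f` is a quasi-isomorphism: it induces an isomorphism in cohomology. -/
def Hom.IsQuasiIso {A : CommDGA.{u}} {B : CommDGA.{v}} (f : Hom A B) : Prop :=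
  Function.Bijective f.mapCohomology

end CommDGA

/-! ### Differential graded Lie algebras -/

/-- A differential graded Lie algebra `L = ⨁ L^i` over `ℚ`, with differential of degree `+1`. -/
structure DGLieAlg where
  carrier : Type u
  [addCommGroup : AddCommGroup carrier]
  [module : Module ℚ carrier]
  gr : ℤ → Submodule ℚ carrier
  [decomposition : DirectSum.Decomposition gr]
  bracket : carrier →ₗ[ℚ] carrier →ₗ[ℚ] carrier
  bracket_mem : ∀ (i j : ℤ) (x y : carrier), x ∈ gr i → y ∈ gr j → bracket x y ∈ gr (i + j)
  antisymm : ∀ (i j : ℤ) (x y : carrier), x ∈ gr i → y ∈ gr j →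
    bracket x y = -(((-1 : ℚ) ^ (i * j)) • bracket y x)
  jacobi : ∀ (i j : ℤ) (x y z : carrier), x ∈ gr i → y ∈ gr j →
    bracket x (bracket y z) =
      bracket (bracket x y) z + ((-1 : ℚ) ^ (i * j)) • bracket y (bracket x z)
  d : carrier →ₗ[ℚ] carrier
  d_mem : ∀ (i : ℤ) (x : carrier), x ∈ gr i → d x ∈ gr (i + 1)
  d_d : ∀ x : carrier, d (d x) = 0
  leibniz : ∀ (i : ℤ) (x y : carrier), x ∈ gr i →
    d (bracket x y) = bracket (d x) y + ((-1 : ℚ) ^ i) • bracket x (d y)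

attribute [instance] DGLieAlg.addCommGroup DGLieAlg.module DGLieAlg.decomposition

namespace DGLieAlg

instance : CoeSort DGLieAlg.{u} (Type u) := ⟨DGLieAlg.carrier⟩

/-- The lower central series; `L.lcs n` is the span of the brackets of length `n + 1`. -/
def lcs (L : DGLieAlg.{u}) : ℕ → Submodule ℚ L
  | 0 => ⊤
  | n + 1 => Submodule.map₂ L.bracket ⊤ (L.lcs n)

def IsNilpotent (L : DGLieAlg.{u}) : Prop := ∃ n : ℕ, L.lcs n = ⊥

/-- `L` is concentrated in nonpositive degrees. -/
def IsNonpos (L : DGLieAlg.{u}) : Prop := ∀ i : ℤ, 0 < i → L.gr i = ⊥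

/-- Morphisms of DGLAs. -/
structure Hom (L : DGLieAlg.{u}) (M : DGLieAlg.{v}) where
  toLinearMap : L →ₗ[ℚ] M
  map_gr : ∀ (i : ℤ) (x : L), x ∈ L.gr i → toLinearMap x ∈ M.gr i
  map_bracket : ∀ x y : L, toLinearMap (L.bracket x y) = M.bracket (toLinearMap x) (toLinearMap y)
  map_d : ∀ x : L, toLinearMap (L.d x) = M.d (toLinearMap x)

end DGLieAlg

/-! ### The DGLA structure on `A ⊗ L` -/

section Tensor

variable (A : CommDGA.{u}) (L : DGLieAlg.{v})

/-- The bracket on `A ⊗ L`: see `tensorBracket_tmul` for its values on homogeneous tensors. -/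
def tensorBracket : (A ⊗[ℚ] L) →ₗ[ℚ] (A ⊗[ℚ] L) →ₗ[ℚ] (A ⊗[ℚ] L) :=
  TensorProduct.lift <| LinearMap.flip <|
    (DirectSum.toModule ℚ ℤ (A →ₗ[ℚ] (A ⊗[ℚ] L) →ₗ[ℚ] (A ⊗[ℚ] L)) fun i =>
      ((TensorProduct.mapBilinear (RingHom.id ℚ) A L A L).compl₁₂
        ((LinearMap.mul ℚ A).compl₂ (signTwist A.gr i)) L.bracket).flip ∘ₗ (L.gr i).subtype) ∘ₗ
    (DirectSum.decomposeLinearEquiv L.gr).toLinearMap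

/-- `[b₁ ⊗ w₁, b₂ ⊗ w₂] = (-1)^(|w₁| |b₂|) (b₁ b₂) ⊗ [w₁, w₂]`. -/
theorem tensorBracket_tmul (i j : ℤ) (b₁ b₂ : A) (w₁ w₂ : L) (hw₁ : w₁ ∈ L.gr i)
    (hb₂ : b₂ ∈ A.gr j) :
    tensorBracket A L (b₁ ⊗ₜ w₁) (b₂ ⊗ₜ w₂) =
      ((-1 : ℚ) ^ (i * j)) • ((b₁ * b₂) ⊗ₜ[ℚ] L.bracket w₁ w₂) := by
  simp only [tensorBracket, TensorProduct.lift.tmul, LinearMap.flip_apply, LinearMap.comp_apply,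
    LinearEquiv.coe_coe, DirectSum.decomposeLinearEquiv_apply]
  rw [DirectSum.decompose_of_mem L.gr hw₁]
  have := DirectSum.toModule_lof (R := ℚ) (M := fun i => L.gr i)
    (φ := fun i => ((TensorProduct.mapBilinear (RingHom.id ℚ) A L A L).compl₁₂
        ((LinearMap.mul ℚ A).compl₂ (signTwist A.gr i)) L.bracket).flip ∘ₗ (L.gr i).subtype)
    i ⟨w₁, hw₁⟩
  refine (congrArg (fun g => g b₁ (b₂ ⊗ₜ[ℚ] w₂)) this).trans ?_
  simp [signTwist_apply A.gr i j hb₂, TensorProduct.smul_tmul']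

/-- The differential on `A ⊗ L`: `d (b ⊗ w) = (d b) ⊗ w + (-1)^|b| b ⊗ (d w)`. -/
def tensorD : (A ⊗[ℚ] L) →ₗ[ℚ] (A ⊗[ℚ] L) :=
  TensorProduct.map A.d LinearMap.id + TensorProduct.map (signTwist A.gr 1) L.d

theorem tensorD_tmul (i : ℤ) (b : A) (w : L) (hb : b ∈ A.gr i) :
    tensorD A L (b ⊗ₜ w) = A.d b ⊗ₜ[ℚ] w + ((-1 : ℚ) ^ i) • (b ⊗ₜ[ℚ] L.d w) := by
  simp [tensorD, signTwist_apply A.gr 1 i hb, TensorProduct.smul_tmul']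

/-- The degree `n` part `(A^+ ⊗ L)^n = ⨁_{i > 0} A^i ⊗ L^(n - i)` of `A^+ ⊗ L`, where
`A^+ = ⨁_{i > 0} A^i`, as a subspace of `A ⊗ L`. -/
def tensorPosGr (n : ℤ) : Submodule ℚ (A ⊗[ℚ] L) :=
  ⨆ (i : ℤ) (_ : 0 < i),
    LinearMap.range (TensorProduct.map (A.gr i).subtype (L.gr (n - i)).subtype)

/-- The curvature `F(α) = d α + ½ [α, α]`. -/
def curvature (α : A ⊗[ℚ] L) : A ⊗[ℚ] L :=
  tensorD A L α + (1 / 2 : ℚ) • tensorBracket A L α α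

/-- `α` is a Maurer-Cartan element of `A^+ ⊗ L`: it has degree `1` and `F(α) = 0`. -/
def IsMaurerCartan (α : A ⊗[ℚ] L) : Prop :=
  α ∈ tensorPosGr A L 1 ∧ curvature A L α = 0

end Tensor

/-! ### MC higher products -/

/-- An MC-product data: a central extension `0 → Z → L̃ → L → 0` of nilpotent DGLAs concentrated in
nonpositive degrees, with `Z ⊆ ker d̃` and `im d̃ ∩ Z = 0`, and an isomorphism of graded vector
spaces from `Z` to a copy of `ℚ` in degree `q ≤ 0`. Here `Z` is the kernel of `π : L̃ → L`. -/
structure MCProductData where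
  Lt : DGLieAlg.{u}
  L : DGLieAlg.{v}
  nilpotent_Lt : Lt.IsNilpotent
  nilpotent_L : L.IsNilpotent
  nonpos_Lt : Lt.IsNonpos
  nonpos_L : L.IsNonpos
  π : DGLieAlg.Hom Lt L
  surjective : Function.Surjective π.toLinearMap
  central : ∀ z ∈ LinearMap.ker π.toLinearMap, ∀ x : Lt, Lt.bracket z x = 0
  le_ker_d : LinearMap.ker π.toLinearMap ≤ LinearMap.ker Lt.d
  range_d_inf : LinearMap.range Lt.d ⊓ LinearMap.ker π.toLinearMap = ⊥
  q : ℤ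
  q_nonpos : q ≤ 0
  iso : LinearMap.ker π.toLinearMap ≃ₗ[ℚ] ℚ
  le_gr_q : LinearMap.ker π.toLinearMap ≤ Lt.gr q

namespace MCProductData

/-- The generator of `Z` that corresponds to `1 : ℚ`. -/
def z (Λ : MCProductData.{u, v}) : Λ.Lt := (Λ.iso.symm 1 : LinearMap.ker Λ.π.toLinearMap)

/-- A defining system: a Maurer-Cartan element of `A^+ ⊗ L`. -/
def IsDefiningSystem (Λ : MCProductData.{u, v}) (A : CommDGA.{w}) (α : A ⊗[ℚ] Λ.L) : Prop :=
  IsMaurerCartan A Λ.L α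

/-- `h` is the MC higher product `m(α) = [F(α̃)]`, where `α̃` is a lift of `α` to a degree one element
of `A^+ ⊗ L̃`: the element `F(α̃)` of `A^+ ⊗ Z` is identified with an element `c` of `A^+` through
`F(α̃) = c ⊗ z`, and `h` is the cohomology class of `c`. The class does not depend on the lift. -/
def IsMCProduct (Λ : MCProductData.{u, v}) (A : CommDGA.{w}) (α : A ⊗[ℚ] Λ.L)
    (h : A.Cohomology) : Prop :=
  ∃ αt ∈ tensorPosGr A Λ.Lt 1, TensorProduct.map LinearMap.id Λ.π.toLinearMap αt = α ∧
    ∃ (c : A) (hc : A.d c = 0), curvature A Λ.Lt αt = c ⊗ₜ[ℚ] Λ.z ∧ h = A.cls c hc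

/-- `MP_λ(A) ⊆ H^•(A)`: the set of the MC higher products of all defining systems. -/
def MP (Λ : MCProductData.{u, v}) (A : CommDGA.{w}) : Set A.Cohomology :=
  {h | ∃ α : A ⊗[ℚ] Λ.L, Λ.IsDefiningSystem A α ∧ Λ.IsMCProduct A α h}

end MCProductData

end

/-!
MC higher products are functorial, so `f_*` maps `MP_λ(A)` to `MP_λ(B)`, and this map is injective
because `f_*` is. The content is surjectivity.

For a *surjective* morphism `p : C → B` with acyclic kernel `K`, defining systems lift strictly:
an element `β` of degree one of `B ⊗ L̃` with `F(β) = c ⊗ z` lifts to `γ` with `F(γ) = c' ⊗ z` and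
`p c' = c` (`MCProductData.exists_curvature_lift`). One starts with any lift and improves it along
the lower central series of `L̃`: a contracting homotopy of `K` (`CommDGA.exists_contraction`)
induces one of `K ⊗ L̃`, and subtracting from `γ` its value on the part of `F(γ)` in `K ⊗ L̃`
pushes the error one step further down, by the Bianchi identity (`tensorD_curvature`).

A general `f : A → B` is replaced by its mapping path object `C`, the pullback of `f` and the
evaluation `B[t, dt] → B` at `t = 0`. Evaluation at `t = 1` is a surjection `p : C → B`, whose
kernel is acyclic if `f` is a quasi-isomorphism (`CommDGA.mappingPathEnd_ker_acyclic`). A class in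
`MP_λ(B)` thus comes from `MP_λ(C)`; its image in `MP_λ(A)` under the projection `C → A` is sent
by `f_*` to the given class, since `p` and `C → A → B` agree in cohomology
(`CommDGA.exists_d_eq_end_sub`). -/

/-! ### Differential graded Lie algebra structure of `A ⊗ L` -/

theorem neg_one_zpow_eq {m n : ℤ} (h : Even (m - n)) : (-1 : ℚ) ^ m = (-1 : ℚ) ^ n := by
  have : m = (m - n) + n := by ring
  rw [this, zpow_add₀ (by norm_num), h.neg_one_zpow, one_mul]

section Tensor

/-- A property of elements of `A ⊗ L` that is additive holds as soon as it holds for the tensors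
`b ⊗ w` with `b` and `w` homogeneous. The scalars are absorbed into `b`. -/
theorem tensor_hom_induction (A : CommDGA.{u}) (L : DGLieAlg.{v}) {P : A ⊗[ℚ] L → Prop}
    (tmul : ∀ (i j : ℤ) (b : A) (w : L), b ∈ A.gr i → w ∈ L.gr j → P (b ⊗ₜ w))
    (add : ∀ x y, P x → P y → P (x + y)) (x : A ⊗[ℚ] L) : P x := by
  have h0 : P 0 := by simpa using tmul 0 0 0 0 (zero_mem _) (zero_mem _)
  induction x with
  | zero => exact h0
  | add x y hx hy => exact add x y hx hy
  | tmul b w =>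
    induction b using DirectSum.Decomposition.inductionOn A.gr with
    | zero => simpa using h0
    | add a b ha hb => rw [TensorProduct.add_tmul]; exact add _ _ ha hb
    | homogeneous b =>
      induction w using DirectSum.Decomposition.inductionOn L.gr with
      | zero => simpa using h0
      | add a b ha hb => rw [TensorProduct.tmul_add]; exact add _ _ ha hb
      | homogeneous w => exact tmul _ _ _ _ b.2 w.2

variable {A : CommDGA.{u}} {L : DGLieAlg.{v}}

/-- The degree `n` part `⨁_i A^i ⊗ L^(n - i)` of `A ⊗ L`. It agrees with
`tensorPosGr A L n` when `L` lives in degrees `≤ 0` and `n > 0`. -/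
def tensorGr (A : CommDGA.{u}) (L : DGLieAlg.{v}) (n : ℤ) : Submodule ℚ (A ⊗[ℚ] L) :=
  ⨆ i : ℤ, LinearMap.range (TensorProduct.map (A.gr i).subtype (L.gr (n - i)).subtype)

theorem tensorPosGr_le_tensorGr (n : ℤ) : tensorPosGr A L n ≤ tensorGr A L n :=
  iSup_mono fun _ => iSup_le fun _ => le_rfl

theorem tmul_mem_tensorGr {i j n : ℤ} {b : A} {w : L} (hb : b ∈ A.gr i) (hw : w ∈ L.gr j)
    (h : i + j = n) : b ⊗ₜ[ℚ] w ∈ tensorGr A L n := by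
  obtain rfl : j = n - i := by omega
  exact Submodule.mem_iSup_of_mem i ⟨(⟨b, hb⟩ : A.gr i) ⊗ₜ (⟨w, hw⟩ : L.gr (n - i)), rfl⟩

theorem tensorGr_induction {n : ℤ} {P : A ⊗[ℚ] L → Prop}
    (tmul : ∀ (i j : ℤ) (b : A) (w : L), b ∈ A.gr i → w ∈ L.gr j → i + j = n → P (b ⊗ₜ w))
    (add : ∀ x y, P x → P y → P (x + y)) {x : A ⊗[ℚ] L} (hx : x ∈ tensorGr A L n) : P x := by
  have h0 : P 0 := by
    simpa using tmul 0 n 0 0 (zero_mem _) (zero_mem _) (by ring)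
  refine Submodule.iSup_induction _ (motive := P) hx ?_ h0 add
  rintro i _ ⟨y, rfl⟩
  induction y with
  | zero => simpa using h0
  | add x y hx hy => rw [map_add]; exact add _ _ hx hy
  | tmul b w => exact tmul i (n - i) b w b.2 w.2 (by ring)

theorem tensorGr_le_tensorPosGr (hL : L.IsNonpos) {n : ℤ} (hn : 0 < n) :
    tensorGr A L n ≤ tensorPosGr A L n := by
  intro x hx
  refine tensorGr_induction (P := fun x => x ∈ tensorPosGr A L n) ?_
    (fun x y hx hy => add_mem hx hy) hx
  intro i j b w hb hw hij
  obtain hi | hi := lt_or_ge 0 i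
  · obtain rfl : j = n - i := by omega
    exact Submodule.mem_iSup_of_mem i (Submodule.mem_iSup_of_mem hi
      ⟨(⟨b, hb⟩ : A.gr i) ⊗ₜ (⟨w, hw⟩ : L.gr (n - i)), rfl⟩)
  · rw [hL j (by omega), Submodule.mem_bot] at hw
    simp [hw]

theorem tensorD_mem {n : ℤ} {x : A ⊗[ℚ] L} (hx : x ∈ tensorGr A L n) :
    tensorD A L x ∈ tensorGr A L (n + 1) := by
  refine tensorGr_induction (P := fun x => tensorD A L x ∈ tensorGr A L (n + 1)) ?_
    (fun x y hx hy => by rw [map_add]; exact add_mem hx hy) hx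
  intro i j b w hb hw hij
  rw [tensorD_tmul A L i b w hb]
  exact add_mem (tmul_mem_tensorGr (A.d_mem i b hb) hw (by omega))
    (Submodule.smul_mem _ _ (tmul_mem_tensorGr hb (L.d_mem j w hw) (by omega)))

theorem tensorBracket_mem {m n : ℤ} {x y : A ⊗[ℚ] L} (hx : x ∈ tensorGr A L m)
    (hy : y ∈ tensorGr A L n) : tensorBracket A L x y ∈ tensorGr A L (m + n) := by
  refine tensorGr_induction (P := fun x => tensorBracket A L x y ∈ tensorGr A L (m + n)) ?_
    (fun x y hx hy => by rw [map_add]; exact add_mem hx hy) hx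
  intro i j b w hb hw hij
  refine tensorGr_induction
    (P := fun y => tensorBracket A L (b ⊗ₜ w) y ∈ tensorGr A L (m + n)) ?_
    (fun x y hx hy => by rw [map_add]; exact add_mem hx hy) hy
  intro i' j' b' w' hb' hw' hij'
  rw [tensorBracket_tmul A L j i' b b' w w' hw hb']
  exact Submodule.smul_mem _ _ (tmul_mem_tensorGr (SetLike.mul_mem_graded hb hb')
    (L.bracket_mem _ _ _ _ hw hw') (by omega))

theorem curvature_mem {x : A ⊗[ℚ] L} (hx : x ∈ tensorGr A L 1) :
    curvature A L x ∈ tensorGr A L 2 := by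
  rw [show (2 : ℤ) = 1 + 1 from rfl]
  exact add_mem (tensorD_mem hx) (Submodule.smul_mem _ _ (tensorBracket_mem hx hx))

theorem tensorD_tensorD (x : A ⊗[ℚ] L) : tensorD A L (tensorD A L x) = 0 := by
  refine tensor_hom_induction A L (P := fun x => tensorD A L (tensorD A L x) = 0) ?_
    (fun x y hx hy => by rw [map_add, map_add, hx, hy, add_zero]) x
  intro i j b w hb hw
  rw [tensorD_tmul A L i b w hb, map_add, map_smul, tensorD_tmul A L _ _ _ (A.d_mem i b hb),
    tensorD_tmul A L i _ _ hb, A.d_d, L.d_d]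
  rw [zpow_add₀ (by norm_num)]
  simp
  module

theorem tensorBracket_antisymm {m n : ℤ} {x y : A ⊗[ℚ] L} (hx : x ∈ tensorGr A L m)
    (hy : y ∈ tensorGr A L n) :
    tensorBracket A L x y = -(((-1 : ℚ) ^ (m * n)) • tensorBracket A L y x) := by
  refine tensorGr_induction (P := fun x =>
    tensorBracket A L x y = -(((-1 : ℚ) ^ (m * n)) • tensorBracket A L y x)) ?_
    (fun x y hx hy => by simp only [map_add, LinearMap.add_apply, hx, hy, smul_add, neg_add]) hx
  rintro i j b w hb hw rfl
  refine tensorGr_induction (P := fun y => tensorBracket A L (b ⊗ₜ w) y =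
    -(((-1 : ℚ) ^ ((i + j) * n)) • tensorBracket A L y (b ⊗ₜ w))) ?_
    (fun x y hx hy => by simp only [map_add, LinearMap.add_apply, hx, hy, smul_add, neg_add]) hy
  rintro i' j' b' w' hb' hw' rfl
  rw [tensorBracket_tmul A L j i' b b' w w' hw hb', tensorBracket_tmul A L j' i b' b w' w hw' hb,
    A.mul_comm_graded i i' b b' hb hb', L.antisymm j j' w w' hw hw']
  simp only [TensorProduct.tmul_neg, TensorProduct.tmul_smul, ← TensorProduct.smul_tmul',
    smul_neg, smul_smul, ← zpow_add₀ (show (-1 : ℚ) ≠ 0 by norm_num)]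
  rw [neg_one_zpow_eq]
  exact ⟨-(i * j'), by ring⟩

theorem tensorD_tensorBracket {m : ℤ} {x : A ⊗[ℚ] L} (hx : x ∈ tensorGr A L m) (y : A ⊗[ℚ] L) :
    tensorD A L (tensorBracket A L x y) = tensorBracket A L (tensorD A L x) y +
      ((-1 : ℚ) ^ m) • tensorBracket A L x (tensorD A L y) := by
  refine tensorGr_induction (P := fun x => tensorD A L (tensorBracket A L x y) =
    tensorBracket A L (tensorD A L x) y +
      ((-1 : ℚ) ^ m) • tensorBracket A L x (tensorD A L y)) ?_
    (fun x y hx hy => by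
      simp only [map_add, LinearMap.add_apply, hx, hy, smul_add]; abel) hx
  rintro i j b w hb hw rfl
  refine tensor_hom_induction A L (P := fun y => tensorD A L (tensorBracket A L (b ⊗ₜ w) y) =
    tensorBracket A L (tensorD A L (b ⊗ₜ w)) y +
      ((-1 : ℚ) ^ (i + j)) • tensorBracket A L (b ⊗ₜ w) (tensorD A L y)) ?_
    (fun x y hx hy => by simp only [map_add, hx, hy, smul_add]; abel) y
  intro i' j' b' w' hb' hw'
  rw [tensorBracket_tmul A L j i' b b' w w' hw hb', map_smul,
    tensorD_tmul A L (i + i') _ _ (SetLike.mul_mem_graded hb hb'), tensorD_tmul A L i b w hb,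
    tensorD_tmul A L i' b' w' hb', map_add, map_add, LinearMap.add_apply, map_smul, map_smul,
    LinearMap.smul_apply, tensorBracket_tmul A L j i' _ b' w w' hw hb',
    tensorBracket_tmul A L (j + 1) i' b b' _ w' (L.d_mem j w hw) hb',
    tensorBracket_tmul A L j (i' + 1) b _ w w' hw (A.d_mem i' b' hb'),
    tensorBracket_tmul A L j i' b b' w _ hw hb', A.leibniz i b b' hb, L.leibniz j w w' hw]
  simp only [TensorProduct.tmul_add, TensorProduct.add_tmul, smul_add,
    TensorProduct.tmul_smul, ← TensorProduct.smul_tmul', smul_smul,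
    ← zpow_add₀ (show (-1 : ℚ) ≠ 0 by norm_num)]
  rw [neg_one_zpow_eq (m := i + j + j * (i' + 1)) (n := j * i' + i) ⟨j, by ring⟩,
    neg_one_zpow_eq (m := i + (j + 1) * i') (n := j * i' + (i + i')) ⟨0, by ring⟩,
    neg_one_zpow_eq (m := i + j + (i' + j * i')) (n := j * i' + (i + i' + j)) ⟨0, by ring⟩]
  abel

theorem tensorBracket_jacobi {m n : ℤ} {x y : A ⊗[ℚ] L} (hx : x ∈ tensorGr A L m)
    (hy : y ∈ tensorGr A L n) (z : A ⊗[ℚ] L) :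
    tensorBracket A L x (tensorBracket A L y z) = tensorBracket A L (tensorBracket A L x y) z +
      ((-1 : ℚ) ^ (m * n)) • tensorBracket A L y (tensorBracket A L x z) := by
  refine tensorGr_induction (P := fun x => tensorBracket A L x (tensorBracket A L y z) =
    tensorBracket A L (tensorBracket A L x y) z +
      ((-1 : ℚ) ^ (m * n)) • tensorBracket A L y (tensorBracket A L x z)) ?_
    (fun x y hx hy => by
      simp only [map_add, LinearMap.add_apply, hx, hy, smul_add]; abel) hx
  rintro i j b w hb hw rfl
  refine tensorGr_induction (P := fun y => tensorBracket A L (b ⊗ₜ w) (tensorBracket A L y z) =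
    tensorBracket A L (tensorBracket A L (b ⊗ₜ w) y) z +
      ((-1 : ℚ) ^ ((i + j) * n)) • tensorBracket A L y (tensorBracket A L (b ⊗ₜ w) z)) ?_
    (fun x y hx hy => by
      simp only [map_add, LinearMap.add_apply, hx, hy, smul_add]; abel) hy
  rintro i' j' b' w' hb' hw' rfl
  refine tensor_hom_induction A L (P := fun z =>
    tensorBracket A L (b ⊗ₜ w) (tensorBracket A L (b' ⊗ₜ w') z) =
    tensorBracket A L (tensorBracket A L (b ⊗ₜ w) (b' ⊗ₜ w')) z +
      ((-1 : ℚ) ^ ((i + j) * (i' + j'))) •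
        tensorBracket A L (b' ⊗ₜ w') (tensorBracket A L (b ⊗ₜ w) z)) ?_
    (fun x y hx hy => by simp only [map_add, hx, hy, smul_add]; abel) z
  intro i'' j'' b'' w'' hb'' hw''
  rw [tensorBracket_tmul A L j' i'' b' b'' w' w'' hw' hb'',
    tensorBracket_tmul A L j i' b b' w w' hw hb', tensorBracket_tmul A L j i'' b b'' w w'' hw hb'',
    map_smul, map_smul, map_smul, LinearMap.smul_apply,
    tensorBracket_tmul A L j (i' + i'') b _ w _ hw (SetLike.mul_mem_graded hb' hb''),
    tensorBracket_tmul A L j' (i + i'') b' _ w' _ hw' (SetLike.mul_mem_graded hb hb''),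
    tensorBracket_tmul A L (j + j') i'' _ b'' _ w'' (L.bracket_mem j j' w w' hw hw') hb'',
    L.jacobi j j' w w' w'' hw hw', ← mul_assoc b' b, A.mul_comm_graded i' i b' b hb' hb,
    ← mul_assoc]
  simp only [TensorProduct.tmul_add, smul_mul_assoc, smul_add, TensorProduct.tmul_smul,
    ← TensorProduct.smul_tmul', smul_smul, ← zpow_add₀ (show (-1 : ℚ) ≠ 0 by norm_num)]
  rw [neg_one_zpow_eq (m := j' * i'' + j * (i' + i'')) (n := j * i' + (j + j') * i'')
      ⟨0, by ring⟩,
    neg_one_zpow_eq (m := j' * i'' + (j * (i' + i'') + j * j'))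
      (n := (i + j) * (i' + j') + (j * i'' + (j' * (i + i'') + i' * i)))
      ⟨-(i * i' + i * j'), by ring⟩]

/-- The Bianchi identity `d F(γ) + [γ, F(γ)] = 0` for `γ` of degree one. -/
theorem tensorD_curvature {γ : A ⊗[ℚ] L} (hγ : γ ∈ tensorGr A L 1) :
    tensorD A L (curvature A L γ) = -tensorBracket A L γ (curvature A L γ) := by
  have h1 := tensorD_tensorBracket hγ γ
  have h2 := tensorBracket_antisymm (tensorD_mem hγ) hγ
  have h3 := tensorBracket_jacobi hγ hγ γ
  have h4 := tensorBracket_antisymm (tensorBracket_mem hγ hγ) hγ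
  norm_num at h1 h2 h3 h4
  -- The Jacobi identity gives `3 [γ, [γ, γ]] = 0`.
  have h5 : tensorBracket A L γ (tensorBracket A L γ γ) = 0 := by
    rw [h4] at h3
    have : (3 : ℚ) • tensorBracket A L γ (tensorBracket A L γ γ) = 0 := by
      linear_combination (norm := module) h3
    simpa using this
  simp only [curvature, map_add, map_smul, tensorD_tensorD, h1, h2, h5]
  module

theorem curvature_sub {γ ξ : A ⊗[ℚ] L} (hγ : γ ∈ tensorGr A L 1) (hξ : ξ ∈ tensorGr A L 1) :
    curvature A L (γ - ξ) = curvature A L γ - tensorD A L ξ - tensorBracket A L γ ξ +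
      (1 / 2 : ℚ) • tensorBracket A L ξ ξ := by
  have h := tensorBracket_antisymm hξ hγ
  norm_num at h
  simp only [curvature, map_sub, LinearMap.sub_apply, h]
  module

end Tensor

section Functoriality

variable {A : CommDGA.{u}} {B : CommDGA.{w}} {L : DGLieAlg.{v}} {M : DGLieAlg.{t}}

/-- The map `A ⊗ L → B ⊗ M` induced by morphisms `A → B` and `L → M`. -/
def tensorMap (f : CommDGA.Hom A B) (g : DGLieAlg.Hom L M) : A ⊗[ℚ] L →ₗ[ℚ] B ⊗[ℚ] M :=
  TensorProduct.map f.toAlgHom.toLinearMap g.toLinearMap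

variable (f : CommDGA.Hom A B) (g : DGLieAlg.Hom L M)

@[simp] theorem tensorMap_tmul (b : A) (w : L) :
    tensorMap f g (b ⊗ₜ w) = f.toAlgHom b ⊗ₜ g.toLinearMap w := rfl

theorem tensorMap_mem {n : ℤ} {x : A ⊗[ℚ] L} (hx : x ∈ tensorGr A L n) :
    tensorMap f g x ∈ tensorGr B M n :=
  tensorGr_induction (P := fun x => tensorMap f g x ∈ tensorGr B M n)
    (fun i j b w hb hw h => tmul_mem_tensorGr (f.map_gr i b hb) (g.map_gr j w hw) h)
    (fun x y hx hy => by rw [map_add]; exact add_mem hx hy) hx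

theorem tensorD_tensorMap (x : A ⊗[ℚ] L) :
    tensorD B M (tensorMap f g x) = tensorMap f g (tensorD A L x) := by
  refine tensor_hom_induction A L
    (P := fun x => tensorD B M (tensorMap f g x) = tensorMap f g (tensorD A L x)) ?_
    (fun x y hx hy => by simp only [map_add, hx, hy]) x
  intro i j b w hb hw
  rw [tensorMap_tmul, tensorD_tmul B M i _ _ (f.map_gr i b hb), tensorD_tmul A L i b w hb]
  simp [f.map_d, g.map_d]

theorem tensorBracket_tensorMap (x y : A ⊗[ℚ] L) :
    tensorBracket B M (tensorMap f g x) (tensorMap f g y) =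
      tensorMap f g (tensorBracket A L x y) := by
  refine tensor_hom_induction A L (P := fun x => tensorBracket B M (tensorMap f g x)
      (tensorMap f g y) = tensorMap f g (tensorBracket A L x y)) ?_
    (fun x y hx hy => by simp only [map_add, LinearMap.add_apply, hx, hy]) x
  intro i j b w hb hw
  refine tensor_hom_induction A L (P := fun y => tensorBracket B M (tensorMap f g (b ⊗ₜ w))
      (tensorMap f g y) = tensorMap f g (tensorBracket A L (b ⊗ₜ w) y)) ?_
    (fun x y hx hy => by simp only [map_add, hx, hy]) y
  intro i' j' b' w' hb' hw'
  rw [tensorMap_tmul, tensorMap_tmul, tensorBracket_tmul B M j i' _ _ _ _ (g.map_gr j w hw)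
    (f.map_gr i' b' hb'), tensorBracket_tmul A L j i' b b' w w' hw hb']
  simp [g.map_bracket]

theorem curvature_tensorMap (x : A ⊗[ℚ] L) :
    curvature B M (tensorMap f g x) = tensorMap f g (curvature A L x) := by
  simp only [curvature, tensorD_tensorMap, tensorBracket_tensorMap, map_add, map_smul]

/-- The identity morphism of a commutative DGA. -/
def CommDGA.Hom.id (A : CommDGA.{u}) : CommDGA.Hom A A where
  toAlgHom := AlgHom.id ℚ A
  map_gr _ _ h := h
  map_d _ := rfl

/-- The identity morphism of a DGLA. -/
def DGLieAlg.Hom.id (L : DGLieAlg.{u}) : DGLieAlg.Hom L L where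
  toLinearMap := LinearMap.id
  map_gr _ _ h := h
  map_bracket _ _ := rfl
  map_d _ := rfl

end Functoriality

/-! ### Contractions of acyclic homogeneous subcomplexes -/

section Graded

variable {M : Type u} [AddCommGroup M] [Module ℚ M] (gr : ℤ → Submodule ℚ M)
  [DirectSum.Decomposition gr]

/-- The projection of a graded vector space onto its degree `i` part, as an endomorphism. -/
noncomputable def grProj (i : ℤ) : M →ₗ[ℚ] M :=
  (gr i).subtype ∘ₗ DirectSum.component ℚ ℤ (fun i => gr i) i ∘ₗ
    (DirectSum.decomposeLinearEquiv gr).toLinearMap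

theorem grProj_mem (i : ℤ) (x : M) : grProj gr i x ∈ gr i := (DirectSum.decompose gr x i).2

theorem grProj_of_mem {i : ℤ} {x : M} (hx : x ∈ gr i) : grProj gr i x = x :=
  DirectSum.decompose_of_mem_same gr hx

theorem grProj_of_mem_ne {i j : ℤ} {x : M} (hx : x ∈ gr i) (h : i ≠ j) : grProj gr j x = 0 :=
  DirectSum.decompose_of_mem_ne gr hx h

theorem grProj_map {N : Type v} [AddCommGroup N] [Module ℚ N] (gr' : ℤ → Submodule ℚ N)
    [DirectSum.Decomposition gr'] (φ : M →ₗ[ℚ] N) (k : ℤ)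
    (hφ : ∀ i, ∀ x ∈ gr i, φ x ∈ gr' (i + k)) (i : ℤ) (x : M) :
    grProj gr' (i + k) (φ x) = φ (grProj gr i x) := by
  induction x using DirectSum.Decomposition.inductionOn gr with
  | zero => simp
  | add a b ha hb => simp only [map_add, ha, hb]
  | @homogeneous j a =>
    obtain rfl | h := eq_or_ne j i
    · rw [grProj_of_mem gr a.2, grProj_of_mem gr' (hφ _ _ a.2)]
    · rw [grProj_of_mem_ne gr a.2 h, grProj_of_mem_ne gr' (hφ _ _ a.2) (by omega), map_zero]

/-- A linear map may be prescribed degree by degree. -/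
theorem exists_linearMap_of_gr {N : Type v} [AddCommGroup N] [Module ℚ N] (φ : ℤ → M →ₗ[ℚ] N) :
    ∃ s : M →ₗ[ℚ] N, ∀ i, ∀ x ∈ gr i, s x = φ i x := by
  refine ⟨(DirectSum.toModule ℚ ℤ N fun j => φ j ∘ₗ (gr j).subtype) ∘ₗ
    (DirectSum.decomposeLinearEquiv gr).toLinearMap, fun i x hx => ?_⟩
  simp only [LinearMap.comp_apply, LinearEquiv.coe_coe, DirectSum.decomposeLinearEquiv_apply]
  rw [DirectSum.decompose_of_mem gr hx]
  exact DirectSum.toModule_lof (R := ℚ) (M := fun i => gr i) i ⟨x, hx⟩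

/-- Induction on the elements of a homogeneous subspace. -/
theorem gr_submodule_induction {K : Submodule ℚ M} (hK : ∀ i, ∀ x ∈ K, grProj gr i x ∈ K)
    {P : M → Prop} (zero : P 0) (add : ∀ x y, P x → P y → P (x + y))
    (homogeneous : ∀ i, ∀ x ∈ gr i, x ∈ K → P x) {x : M} (hx : x ∈ K) : P x := by
  classical
  rw [← DirectSum.sum_support_decompose gr x]
  exact Finset.sum_induction _ P add zero
    fun i _ => homogeneous i _ (DirectSum.decompose gr x i).2 (hK i x hx)

end Graded

theorem CommDGA.grProj_d (C : CommDGA.{u}) (i : ℤ) (x : C) :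
    grProj C.gr (i + 1) (C.d x) = C.d (grProj C.gr i x) :=
  grProj_map C.gr C.gr C.d 1 C.d_mem i x

theorem CommDGA.Hom.grProj_map {A : CommDGA.{u}} {B : CommDGA.{v}} (f : CommDGA.Hom A B) (i : ℤ)
    (x : A) : grProj B.gr i (f.toAlgHom x) = f.toAlgHom (grProj A.gr i x) := by
  simpa using _root_.grProj_map A.gr B.gr f.toAlgHom.toLinearMap 0
    (fun i x hx => by simpa using f.map_gr i x hx) i x

/-- An acyclic homogeneous subcomplex `K` of a commutative DGA has a contracting homotopy, which
extends to a linear map of degree `-1` on the whole algebra: if `s` is a section, of degree `-1`, of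
`d : K → K ∩ ker d`, then `h = s (1 - s d)` satisfies `d h + h d = 1` on `K`. -/
theorem CommDGA.exists_contraction (C : CommDGA.{u}) (K : Submodule ℚ C)
    (hK : ∀ i, ∀ x ∈ K, grProj C.gr i x ∈ K) (hdK : ∀ x ∈ K, C.d x ∈ K)
    (hac : ∀ x ∈ K, C.d x = 0 → ∃ y ∈ K, C.d y = x) :
    ∃ h : C →ₗ[ℚ] C, (∀ i, ∀ x ∈ C.gr i, h x ∈ C.gr (i - 1)) ∧ (∀ x ∈ K, h x ∈ K) ∧
      ∀ x ∈ K, C.d (h x) + h (C.d x) = x := by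
  let Z : Submodule ℚ C := K ⊓ LinearMap.ker C.d
  let dK : K →ₗ[ℚ] Z := C.d.restrict fun x hx => ⟨hdK x hx, C.d_d x⟩
  have hdKs : Function.Surjective dK := by
    rintro ⟨z, hz, hz'⟩
    obtain ⟨y, hy, rfl⟩ := hac z hz hz'
    exact ⟨⟨y, hy⟩, rfl⟩
  obtain ⟨g, hg⟩ := dK.exists_rightInverse_of_surjective (LinearMap.range_eq_top.2 hdKs)
  obtain ⟨s₀, hs₀⟩ := (K.subtype ∘ₗ g).exists_extend
  have hs₀K : ∀ z ∈ Z, s₀ z ∈ K := fun z hz => by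
    have : s₀ z = g ⟨z, hz⟩ := LinearMap.congr_fun hs₀ ⟨z, hz⟩
    rw [this]; exact (g ⟨z, hz⟩).2
  have hs₀d : ∀ z ∈ Z, C.d (s₀ z) = z := fun z hz => by
    have : s₀ z = g ⟨z, hz⟩ := LinearMap.congr_fun hs₀ ⟨z, hz⟩
    rw [this]
    exact congrArg Subtype.val (LinearMap.congr_fun hg ⟨z, hz⟩)
  -- The section `s₀` need not be homogeneous; keep its component of degree `-1`.
  obtain ⟨s, hs⟩ := exists_linearMap_of_gr C.gr fun i => grProj C.gr (i - 1) ∘ₗ s₀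
  have hZ : ∀ i, ∀ x ∈ Z, grProj C.gr i x ∈ Z := fun i x hx =>
    ⟨hK i x hx.1, by
      rw [SetLike.mem_coe, LinearMap.mem_ker, ← C.grProj_d, LinearMap.mem_ker.1 hx.2, map_zero]⟩
  have hsZ : ∀ z ∈ Z, s z ∈ K ∧ C.d (s z) = z := fun z hz => by
    refine gr_submodule_induction C.gr hZ (P := fun z => s z ∈ K ∧ C.d (s z) = z) (by simp)
      (fun x y hx hy => ⟨by rw [map_add]; exact add_mem hx.1 hy.1, by
        rw [map_add, map_add, hx.2, hy.2]⟩) (fun i x hx hxZ => ?_) hz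
    rw [hs i x hx]
    refine ⟨hK _ _ (hs₀K x hxZ), ?_⟩
    rw [LinearMap.comp_apply, ← C.grProj_d, hs₀d x hxZ, sub_add_cancel, grProj_of_mem _ hx]
  have hsgr : ∀ i, ∀ x ∈ C.gr i, s x ∈ C.gr (i - 1) := fun i x hx => by
    rw [hs i x hx]; exact grProj_mem _ _ _
  have hdZ : ∀ x ∈ K, C.d x ∈ Z := fun x hx => ⟨hdK x hx, C.d_d x⟩
  have hxZ : ∀ x ∈ K, x - s (C.d x) ∈ Z := fun x hx =>
    ⟨sub_mem hx (hsZ _ (hdZ x hx)).1, by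
      rw [SetLike.mem_coe, LinearMap.mem_ker, map_sub, (hsZ _ (hdZ x hx)).2, sub_self]⟩
  refine ⟨s ∘ₗ (LinearMap.id - s ∘ₗ C.d), fun i x hx => ?_, fun x hx => ?_, fun x hx => ?_⟩
  · refine hsgr i _ (sub_mem hx ?_)
    simpa using hsgr _ _ (C.d_mem i x hx)
  · exact (hsZ _ (hxZ x hx)).1
  · simp only [LinearMap.comp_apply, LinearMap.sub_apply, LinearMap.id_apply, C.d_d, map_zero,
      sub_zero]
    rw [(hsZ _ (hxZ x hx)).2, sub_add_cancel]

section Sub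

variable {C : CommDGA.{u}} {L : DGLieAlg.{v}}

/-- The subspace `K ⊗ N` of `C ⊗ L`. -/
def tensorSub (K : Submodule ℚ C) (N : Submodule ℚ L) : Submodule ℚ (C ⊗[ℚ] L) :=
  Submodule.map₂ (TensorProduct.mk ℚ C L) K N

theorem tmul_mem_tensorSub {K : Submodule ℚ C} {N : Submodule ℚ L} {b : C} {w : L} (hb : b ∈ K)
    (hw : w ∈ N) : b ⊗ₜ[ℚ] w ∈ tensorSub K N :=
  Submodule.apply_mem_map₂ _ hb hw

theorem tensorSub_le {K : Submodule ℚ C} {N : Submodule ℚ L} {S : Submodule ℚ (C ⊗[ℚ] L)} :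
    tensorSub K N ≤ S ↔ ∀ b ∈ K, ∀ w ∈ N, b ⊗ₜ[ℚ] w ∈ S :=
  Submodule.map₂_le

/-- The bracket of pure tensors of which only `w₁` is homogeneous. -/
theorem tensorBracket_tmul' {i : ℤ} (b₁ b₂ : C) {w₁ : L} (w₂ : L) (hw₁ : w₁ ∈ L.gr i) :
    tensorBracket C L (b₁ ⊗ₜ w₁) (b₂ ⊗ₜ w₂) =
      (b₁ * signTwist C.gr i b₂) ⊗ₜ[ℚ] L.bracket w₁ w₂ := by
  induction b₂ using DirectSum.Decomposition.inductionOn C.gr with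
  | zero => simp
  | add a b ha hb => simp only [TensorProduct.add_tmul, map_add, mul_add, ha, hb]
  | homogeneous b =>
    rw [tensorBracket_tmul C L i _ _ _ _ _ hw₁ b.2, signTwist_apply C.gr i _ b.2, mul_smul_comm,
      TensorProduct.smul_tmul']

theorem signTwist_map {B : CommDGA.{w}} (f : CommDGA.Hom C B) (k : ℤ) (x : C) :
    f.toAlgHom (signTwist C.gr k x) = signTwist B.gr k (f.toAlgHom x) := by
  induction x using DirectSum.Decomposition.inductionOn C.gr with
  | zero => simp
  | add a b ha hb => simp only [map_add, ha, hb]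
  | homogeneous b =>
    rw [signTwist_apply C.gr _ _ b.2, signTwist_apply B.gr _ _ (f.map_gr _ _ b.2), map_smul]

/-- If `K` is an ideal stable under the Koszul signs and `[L, N] ⊆ N'`, then bracketing with any
element of `C ⊗ L` moves `K ⊗ N` into `K ⊗ N'`. -/
theorem tensorBracket_mem_tensorSub {K : Submodule ℚ C} {N N' : Submodule ℚ L}
    (hK : ∀ b, ∀ k ∈ K, b * k ∈ K) (hKs : ∀ i, ∀ k ∈ K, signTwist C.gr i k ∈ K)
    (hN : ∀ w, ∀ w' ∈ N, L.bracket w w' ∈ N') (x : C ⊗[ℚ] L) {y : C ⊗[ℚ] L}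
    (hy : y ∈ tensorSub K N) : tensorBracket C L x y ∈ tensorSub K N' := by
  refine tensor_hom_induction C L (P := fun x => tensorBracket C L x y ∈ tensorSub K N') ?_
    (fun x y hx hy => by simp only [map_add]; exact add_mem hx hy) x
  intro i j b w hb hw
  refine (tensorSub_le (S := (tensorSub K N').comap (tensorBracket C L (b ⊗ₜ w)))).2 ?_ hy
  intro k hk w' hw'
  rw [Submodule.mem_comap, tensorBracket_tmul' _ _ _ hw]
  exact tmul_mem_tensorSub (hK _ _ (hKs _ _ hk)) (hN _ _ hw')

/-- The extension `h ⊗ 1` to `C ⊗ L` of a linear map `h` on `C`. -/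
def tensorHomotopy (L : DGLieAlg.{v}) (h : C →ₗ[ℚ] C) : C ⊗[ℚ] L →ₗ[ℚ] C ⊗[ℚ] L :=
  TensorProduct.map h LinearMap.id

theorem tensorHomotopy_mem_tensorSub {h : C →ₗ[ℚ] C} {K : Submodule ℚ C} (hK : ∀ x ∈ K, h x ∈ K)
    (N : Submodule ℚ L) {x : C ⊗[ℚ] L} (hx : x ∈ tensorSub K N) :
    tensorHomotopy L h x ∈ tensorSub K N :=
  (tensorSub_le (S := (tensorSub K N).comap (tensorHomotopy L h))).2
    (fun b hb _ hw => tmul_mem_tensorSub (hK b hb) hw) hx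

theorem tensorHomotopy_mem {h : C →ₗ[ℚ] C} (hh : ∀ i, ∀ x ∈ C.gr i, h x ∈ C.gr (i - 1)) {n : ℤ}
    {x : C ⊗[ℚ] L} (hx : x ∈ tensorGr C L n) : tensorHomotopy L h x ∈ tensorGr C L (n - 1) :=
  tensorGr_induction (P := fun x => tensorHomotopy L h x ∈ tensorGr C L (n - 1))
    (fun i j b w hb hw hij => tmul_mem_tensorGr (hh i b hb) hw (by omega))
    (fun x y hx hy => by rw [map_add]; exact add_mem hx hy) hx

theorem signTwist_homotopy {h : C →ₗ[ℚ] C} (hh : ∀ i, ∀ x ∈ C.gr i, h x ∈ C.gr (i - 1)) (x : C) :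
    h (signTwist C.gr 1 x) = -signTwist C.gr 1 (h x) := by
  induction x using DirectSum.Decomposition.inductionOn C.gr with
  | zero => simp
  | add a b ha hb => simp only [map_add, ha, hb, neg_add]
  | @homogeneous i b =>
    rw [signTwist_apply C.gr _ _ b.2, signTwist_apply C.gr _ _ (hh _ _ b.2), map_smul, ← neg_smul,
      one_mul, one_mul, zpow_sub₀ (by norm_num)]
    congr 1
    simp [div_neg]

/-- If `h` contracts `K` and has degree `-1`, then `h ⊗ 1` contracts `K ⊗ L`: as `h` anticommutes
with the sign `(-1)^deg`, the contributions of the differential of `L` cancel. -/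
theorem tensorD_tensorHomotopy {h : C →ₗ[ℚ] C} (hh : ∀ i, ∀ x ∈ C.gr i, h x ∈ C.gr (i - 1))
    {K : Submodule ℚ C} (hK : ∀ x ∈ K, C.d (h x) + h (C.d x) = x) {x : C ⊗[ℚ] L}
    (hx : x ∈ tensorSub K ⊤) :
    tensorD C L (tensorHomotopy L h x) + tensorHomotopy L h (tensorD C L x) = x := by
  refine (tensorSub_le (S := LinearMap.eqLocus (tensorD C L ∘ₗ tensorHomotopy L h +
    tensorHomotopy L h ∘ₗ tensorD C L) LinearMap.id)).2 ?_ hx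
  intro b hb w _
  simp only [LinearMap.mem_eqLocus, tensorD, tensorHomotopy, LinearMap.add_apply,
    LinearMap.comp_apply, TensorProduct.map_tmul, LinearMap.id_apply, map_add,
    signTwist_homotopy hh, TensorProduct.neg_tmul]
  conv_rhs => rw [← hK b hb, TensorProduct.add_tmul]
  abel

end Sub

/-! ### Lifting along surjections with acyclic kernel -/

section Lift

variable {C : CommDGA.{w}} {B : CommDGA.{t}} {L : DGLieAlg.{u}}

theorem exists_tensorGr_lift {p : CommDGA.Hom C B} (hp : Function.Surjective p.toAlgHom) {n : ℤ}
    {x : B ⊗[ℚ] L} (hx : x ∈ tensorGr B L n) :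
    ∃ y ∈ tensorGr C L n, tensorMap p (DGLieAlg.Hom.id L) y = x := by
  refine tensorGr_induction
    (P := fun x => ∃ y ∈ tensorGr C L n, tensorMap p (DGLieAlg.Hom.id L) y = x) ?_ ?_ hx
  · intro i j b w hb hw hij
    obtain ⟨a, rfl⟩ := hp b
    refine ⟨grProj C.gr i a ⊗ₜ w, tmul_mem_tensorGr (grProj_mem _ _ _) hw hij, ?_⟩
    rw [tensorMap_tmul, ← p.grProj_map, grProj_of_mem _ hb]
    rfl
  · rintro _ _ ⟨x, hx, rfl⟩ ⟨y, hy, rfl⟩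
    exact ⟨x + y, add_mem hx hy, map_add _ _ _⟩

/-- The kernel of `C ⊗ L → B ⊗ L` is `ker p ⊗ L`, as `⊗` is right exact. -/
theorem mem_tensorSub_ker {p : CommDGA.Hom C B} (hp : Function.Surjective p.toAlgHom)
    {x : C ⊗[ℚ] L} (hx : tensorMap p (DGLieAlg.Hom.id L) x = 0) :
    x ∈ tensorSub (LinearMap.ker p.toAlgHom.toLinearMap) (⊤ : Submodule ℚ L) := by
  have hex : Function.Exact (LinearMap.ker p.toAlgHom.toLinearMap).subtype
      p.toAlgHom.toLinearMap := LinearMap.exact_subtype_ker_map _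
  obtain ⟨y, rfl⟩ := (rTensor_exact L hex hp x).1 hx
  clear hx
  induction y with
  | zero => simp
  | add x y hx hy => rw [map_add]; exact add_mem hx hy
  | tmul k w => exact tmul_mem_tensorSub k.2 Submodule.mem_top

theorem tensorMap_eq_zero {p : CommDGA.Hom C B} {x : C ⊗[ℚ] L} {N : Submodule ℚ L}
    (hx : x ∈ tensorSub (LinearMap.ker p.toAlgHom.toLinearMap) N) :
    tensorMap p (DGLieAlg.Hom.id L) x = 0 :=
  (tensorSub_le (S := LinearMap.ker (tensorMap p (DGLieAlg.Hom.id L)))).2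
    (fun b hb w _ => by
      have : p.toAlgHom b = 0 := hb
      rw [LinearMap.mem_ker, tensorMap_tmul, this, TensorProduct.zero_tmul]) hx

end Lift

namespace MCProductData

variable (Λ : MCProductData.{u, v})

theorem z_mem : Λ.z ∈ LinearMap.ker Λ.π.toLinearMap := (Λ.iso.symm 1).2

theorem z_mem_gr : Λ.z ∈ Λ.Lt.gr Λ.q := Λ.le_gr_q Λ.z_mem

theorem π_z : Λ.π.toLinearMap Λ.z = 0 := Λ.z_mem

theorem d_z : Λ.Lt.d Λ.z = 0 := Λ.le_ker_d Λ.z_mem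

theorem bracket_z (x : Λ.Lt) : Λ.Lt.bracket x Λ.z = 0 := by
  induction x using DirectSum.Decomposition.inductionOn Λ.Lt.gr with
  | zero => simp
  | add a b ha hb => simp only [map_add, LinearMap.add_apply, ha, hb, add_zero]
  | @homogeneous i x =>
    rw [Λ.Lt.antisymm i Λ.q x Λ.z x.2 Λ.z_mem_gr, Λ.central _ Λ.z_mem, smul_zero, neg_zero]

theorem tensorD_tmul_z (C : CommDGA.{w}) (c : C) :
    tensorD C Λ.Lt (c ⊗ₜ Λ.z) = C.d c ⊗ₜ Λ.z := by
  simp [tensorD, Λ.d_z]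

theorem tensorBracket_tmul_z (C : CommDGA.{w}) (x : C ⊗[ℚ] Λ.Lt) (c : C) :
    tensorBracket C Λ.Lt x (c ⊗ₜ Λ.z) = 0 := by
  refine tensor_hom_induction C Λ.Lt (P := fun x => tensorBracket C Λ.Lt x (c ⊗ₜ Λ.z) = 0) ?_
    (fun x y hx hy => by rw [map_add, LinearMap.add_apply, hx, hy, add_zero]) x
  intro i j b w hb hw
  rw [tensorBracket_tmul' _ _ _ hw, Λ.bracket_z, TensorProduct.tmul_zero]

/-- A linear form on `L̃` of degree `-q` that takes the value `1` at `z`. -/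
theorem exists_linearForm :
    ∃ l : Λ.Lt →ₗ[ℚ] ℚ, l Λ.z = 1 ∧ ∀ i ≠ Λ.q, ∀ x ∈ Λ.Lt.gr i, l x = 0 := by
  obtain ⟨l, hl⟩ := Λ.iso.toLinearMap.exists_extend
  refine ⟨l ∘ₗ grProj Λ.Lt.gr Λ.q, ?_, fun i hi x hx => ?_⟩
  · rw [LinearMap.comp_apply, grProj_of_mem _ Λ.z_mem_gr]
    have := LinearMap.congr_fun hl (Λ.iso.symm 1)
    exact this.trans (Λ.iso.apply_symm_apply 1)
  · rw [LinearMap.comp_apply, grProj_of_mem_ne _ hx hi, map_zero]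

/-- There is a linear map `C ⊗ L̃ → C` of degree `-q` that sends `c ⊗ z` to `c`. -/
theorem exists_coeff (C : CommDGA.{w}) : ∃ φ : C ⊗[ℚ] Λ.Lt →ₗ[ℚ] C,
    (∀ c, φ (c ⊗ₜ Λ.z) = c) ∧ ∀ n, ∀ x ∈ tensorGr C Λ.Lt n, φ x ∈ C.gr (n - Λ.q) := by
  obtain ⟨l, hl, hl'⟩ := Λ.exists_linearForm
  refine ⟨(TensorProduct.rid ℚ C).toLinearMap ∘ₗ TensorProduct.map LinearMap.id l,
    fun c => by simp [hl], fun n x hx => ?_⟩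
  refine tensorGr_induction (P := fun x => ((TensorProduct.rid ℚ C).toLinearMap ∘ₗ
    TensorProduct.map LinearMap.id l) x ∈ C.gr (n - Λ.q)) ?_
    (fun x y hx hy => by rw [map_add]; exact add_mem hx hy) hx
  intro i j b w hb hw hij
  obtain rfl | hj := eq_or_ne j Λ.q
  · obtain rfl : i = n - Λ.q := by omega
    simpa using Submodule.smul_mem _ _ hb
  · simp [hl' j hj w hw]

theorem tmul_z_injective (C : CommDGA.{w}) {c c' : C} (h : c ⊗ₜ[ℚ] Λ.z = c' ⊗ₜ[ℚ] Λ.z) :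
    c = c' := by
  obtain ⟨φ, hφ, -⟩ := Λ.exists_coeff C
  rw [← hφ c, h, hφ]

theorem mem_gr_of_tmul_z (C : CommDGA.{w}) {c : C} {n : ℤ}
    (h : c ⊗ₜ[ℚ] Λ.z ∈ tensorGr C Λ.Lt n) : c ∈ C.gr (n - Λ.q) := by
  obtain ⟨φ, hφ, hφ'⟩ := Λ.exists_coeff C
  rw [← hφ c]
  exact hφ' _ _ h

/-- Let `p : C → B` be a surjection with acyclic kernel `K`. An element `β` of degree one of `B ⊗
L̃` whose curvature lies in `B ⊗ Z` lifts to such an element of `C ⊗ L̃`.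

By induction on `n`, there is a lift `γ` whose curvature has the form `R + e ⊗ z` with `R` in `K ⊗
lcs n`. If `H` is the contraction of `K ⊗ L̃`, the Bianchi identity shows that the curvature of
the lift `γ - H R` has this form for `n + 1`; nilpotency ends the induction. -/
theorem exists_curvature_lift {C : CommDGA.{w}} {B : CommDGA.{t}} (p : CommDGA.Hom C B)
    (hp : Function.Surjective p.toAlgHom)
    (hac : ∀ x, p.toAlgHom x = 0 → C.d x = 0 → ∃ y, p.toAlgHom y = 0 ∧ C.d y = x)
    {β : B ⊗[ℚ] Λ.Lt} (hβ : β ∈ tensorGr B Λ.Lt 1) {c : B}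
    (hc : curvature B Λ.Lt β = c ⊗ₜ Λ.z) :
    ∃ γ ∈ tensorGr C Λ.Lt 1, ∃ c' : C, C.d c' = 0 ∧ p.toAlgHom c' = c ∧
      curvature C Λ.Lt γ = c' ⊗ₜ Λ.z := by
  set K : Submodule ℚ C := LinearMap.ker p.toAlgHom.toLinearMap with hKdef
  have hK : ∀ {x}, x ∈ K ↔ p.toAlgHom x = 0 := Iff.rfl
  obtain ⟨h, hh, hhK, hdh⟩ := C.exists_contraction K
    (fun i x hx => by rw [hK] at hx ⊢; rw [← p.grProj_map, hx, map_zero])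
    (fun x hx => by rw [hK] at hx ⊢; rw [p.map_d, hx, map_zero])
    (fun x hx => hac x hx)
  have hKid : ∀ b, ∀ k ∈ K, b * k ∈ K := fun b k hk => by
    rw [hK] at hk ⊢; rw [map_mul, hk, mul_zero]
  have hKs : ∀ i, ∀ k ∈ K, signTwist C.gr i k ∈ K := fun i k hk => by
    rw [hK] at hk ⊢; rw [signTwist_map, hk, map_zero]
  -- The degree of `e` is part of the induction, so that `R` is homogeneous of degree two and `H R`
  -- has degree one.
  have key : ∀ n, ∃ γ ∈ tensorGr C Λ.Lt 1, tensorMap p (DGLieAlg.Hom.id Λ.Lt) γ = β ∧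
      ∃ e ∈ C.gr (2 - Λ.q), curvature C Λ.Lt γ - e ⊗ₜ Λ.z ∈ tensorSub K (Λ.Lt.lcs n) := by
    intro n
    induction n with
    | zero =>
      obtain ⟨γ, hγ, rfl⟩ := exists_tensorGr_lift hp hβ
      have hcgr : c ∈ B.gr (2 - Λ.q) := Λ.mem_gr_of_tmul_z B (hc ▸ curvature_mem hβ)
      obtain ⟨e, rfl⟩ := hp c
      refine ⟨γ, hγ, rfl, grProj C.gr (2 - Λ.q) e, grProj_mem _ _ _, ?_⟩
      refine mem_tensorSub_ker hp ?_
      rw [map_sub, ← curvature_tensorMap, hc, tensorMap_tmul, ← p.grProj_map,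
        grProj_of_mem _ hcgr]
      exact sub_self _
    | succ n ih =>
      obtain ⟨γ, hγ, hγβ, e, he, hR⟩ := ih
      set R := curvature C Λ.Lt γ - e ⊗ₜ Λ.z with hRdef
      have hR2 : R ∈ tensorGr C Λ.Lt 2 := by
        rw [hRdef]
        exact Submodule.sub_mem _ (curvature_mem hγ)
          (tmul_mem_tensorGr he Λ.z_mem_gr (by ring))
      set ξ := tensorHomotopy Λ.Lt h R with hξdef
      have hξ : ξ ∈ tensorGr C Λ.Lt 1 := by
        rw [show (1 : ℤ) = 2 - 1 by norm_num]
        exact tensorHomotopy_mem hh hR2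
      have hξK : ξ ∈ tensorSub K (Λ.Lt.lcs n) := tensorHomotopy_mem_tensorSub hhK _ hR
      have hbr : ∀ x, ∀ y ∈ tensorSub K (Λ.Lt.lcs n),
          tensorBracket C Λ.Lt x y ∈ tensorSub K (Λ.Lt.lcs (n + 1)) := fun x y hy =>
        tensorBracket_mem_tensorSub hKid hKs
          (fun w w' hw' => Submodule.apply_mem_map₂ _ Submodule.mem_top hw') x hy
      have hF : curvature C Λ.Lt γ = R + e ⊗ₜ Λ.z := (sub_add_cancel _ _).symm
      have hDR : tensorD C Λ.Lt R = -tensorBracket C Λ.Lt γ R - C.d e ⊗ₜ Λ.z := by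
        conv_lhs => rw [hRdef]
        rw [map_sub, tensorD_curvature hγ, hF, map_add, Λ.tensorBracket_tmul_z, add_zero,
          Λ.tensorD_tmul_z]
      have hDξ := tensorD_tensorHomotopy hh hdh (Submodule.map₂_le_map₂_right le_top hR)
      rw [← hξdef, hDR, map_sub, map_neg] at hDξ
      have hHz : tensorHomotopy Λ.Lt h (C.d e ⊗ₜ Λ.z) = h (C.d e) ⊗ₜ Λ.z := rfl
      rw [hHz] at hDξ
      refine ⟨γ - ξ, sub_mem hγ hξ, ?_, e - h (C.d e), sub_mem he ?_, ?_⟩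
      · rw [map_sub, hγβ, tensorMap_eq_zero hξK, sub_zero]
      · simpa using hh _ _ (C.d_mem _ e he)
      · have : curvature C Λ.Lt (γ - ξ) - (e - h (C.d e)) ⊗ₜ Λ.z =
            -tensorHomotopy Λ.Lt h (tensorBracket C Λ.Lt γ R) - tensorBracket C Λ.Lt γ ξ +
              (1 / 2 : ℚ) • tensorBracket C Λ.Lt ξ ξ := by
          rw [curvature_sub hγ hξ, hF, TensorProduct.sub_tmul]
          linear_combination (norm := module) -hDξ
        rw [this]
        exact add_mem (sub_mem (neg_mem (tensorHomotopy_mem_tensorSub hhK _ (hbr _ _ hR)))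
          (hbr _ _ hξK)) (Submodule.smul_mem _ _ (hbr _ _ hξK))
  obtain ⟨N, hN⟩ := Λ.nilpotent_Lt
  obtain ⟨γ, hγ, hγβ, e, -, hR⟩ := key N
  rw [hN, tensorSub, Submodule.map₂_bot_right, Submodule.mem_bot, sub_eq_zero] at hR
  refine ⟨γ, hγ, e, Λ.tmul_z_injective C ?_, Λ.tmul_z_injective B ?_, hR⟩
  · rw [← Λ.tensorD_tmul_z, ← hR, tensorD_curvature hγ, hR, Λ.tensorBracket_tmul_z]
    simp
  · rw [← hc, ← hγβ, curvature_tensorMap, hR]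
    rfl

/-- The defining system can be recovered from its lift: `h` is an MC higher product if and only if
it is the class of some `c` with `F(γ) = c ⊗ z`, where `γ` has degree one in `A ⊗ L̃`. -/
theorem mem_MP_iff {A : CommDGA.{w}} {h : A.Cohomology} : h ∈ Λ.MP A ↔
    ∃ γ ∈ tensorGr A Λ.Lt 1, ∃ (c : A) (hc : A.d c = 0),
      curvature A Λ.Lt γ = c ⊗ₜ Λ.z ∧ h = A.cls c hc := by
  constructor
  · rintro ⟨α, -, γ, hγ, -, hc⟩
    exact ⟨γ, tensorPosGr_le_tensorGr _ hγ, hc⟩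
  · rintro ⟨γ, hγ, c, hc, hcurv, hh⟩
    refine ⟨tensorMap (CommDGA.Hom.id A) Λ.π γ, ⟨?_, ?_⟩, γ,
      tensorGr_le_tensorPosGr Λ.nonpos_Lt one_pos hγ, rfl, c, hc, hcurv, hh⟩
    · exact tensorGr_le_tensorPosGr Λ.nonpos_L one_pos (tensorMap_mem _ _ hγ)
    · rw [curvature_tensorMap, hcurv, tensorMap_tmul, Λ.π_z, TensorProduct.tmul_zero]

theorem mapCohomology_cls {A : CommDGA.{w}} {B : CommDGA.{t}} (f : CommDGA.Hom A B) (c : A)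
    (hc : A.d c = 0) : f.mapCohomology (A.cls c hc) =
      B.cls (f.toAlgHom c) (by rw [← f.map_d, hc, map_zero]) := rfl

theorem mapsTo_MP {A : CommDGA.{w}} {B : CommDGA.{t}} (f : CommDGA.Hom A B) :
    Set.MapsTo f.mapCohomology (Λ.MP A) (Λ.MP B) := by
  intro h hh
  obtain ⟨γ, hγ, c, hc, hcurv, rfl⟩ := Λ.mem_MP_iff.1 hh
  refine Λ.mem_MP_iff.2 ⟨tensorMap f (DGLieAlg.Hom.id _) γ, tensorMap_mem _ _ hγ, _, _, ?_,
    mapCohomology_cls f c hc⟩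
  rw [curvature_tensorMap, hcurv]
  rfl

end MCProductData

/-! ### Polynomial paths and pullbacks of commutative DGAs -/

section Internal

variable {M : Type u} [AddCommGroup M] [Module ℚ M] (gr : ℤ → Submodule ℚ M)

/-- A spanning family of subspaces is a grading if there are linear maps `P i` that are the identity
on the `i`-th member and vanish on the others. -/
theorem isInternal_of_proj (P : ℤ → M →ₗ[ℚ] M) (hP : ∀ i, ∀ x ∈ gr i, P i x = x)
    (hP' : ∀ i j, ∀ x ∈ gr i, i ≠ j → P j x = 0) (htop : ∀ x, x ∈ ⨆ i, gr i) :
    DirectSum.IsInternal gr := by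
  classical
  refine DirectSum.isInternal_submodule_of_iSupIndep_of_iSup_eq_top ?_
    (eq_top_iff.2 fun x _ => htop x)
  refine fun i => Submodule.disjoint_def.2 fun x hx hx' => ?_
  rw [← hP i x hx]
  have : (⨆ (j) (_ : j ≠ i), gr j) ≤ LinearMap.ker (P i) :=
    iSup_le fun j => iSup_le fun hj y hy => hP' j i y hy hj
  exact this hx'

end Internal

section Coeff

open Polynomial

theorem Polynomial.exists_coeff_eq {R : Type u} [Semiring R] (a : ℕ → R) (N : ℕ)
    (h : ∀ n, N ≤ n → a n = 0) : ∃ p : R[X], ∀ n, p.coeff n = a n := by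
  refine ⟨∑ n ∈ Finset.range N, monomial n (a n), fun n => ?_⟩
  rw [finsetSum_coeff]
  simp only [coeff_monomial, Finset.sum_ite_eq', Finset.mem_range]
  split_ifs with hn
  · rfl
  · exact (h n (not_lt.1 hn)).symm

variable {R : Type u} [Ring R] [Algebra ℚ R]

/-- The coefficientwise application of a linear map to polynomials. -/
noncomputable def Polynomial.mapCoeff (φ : R →ₗ[ℚ] R) : R[X] →ₗ[ℚ] R[X] :=
  have h (p : R[X]) : ∃ q : R[X], ∀ n, q.coeff n = φ (p.coeff n) :=
    Polynomial.exists_coeff_eq _ (p.natDegree + 1) fun n hn => by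
      rw [coeff_eq_zero_of_natDegree_lt hn, map_zero]
  { toFun := fun p => (h p).choose
    map_add' := fun p q => by
      ext n
      rw [coeff_add, (h _).choose_spec, (h _).choose_spec, (h _).choose_spec, coeff_add, map_add]
    map_smul' := fun r p => by
      ext n
      rw [RingHom.id_apply, coeff_smul, (h _).choose_spec, (h _).choose_spec, coeff_smul,
        map_smul] }

@[simp] theorem Polynomial.coeff_mapCoeff (φ : R →ₗ[ℚ] R) (p : R[X]) (n : ℕ) :
    (mapCoeff φ p).coeff n = φ (p.coeff n) :=
  (Polynomial.exists_coeff_eq (fun n => φ (p.coeff n)) (p.natDegree + 1) fun n hn => by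
      rw [coeff_eq_zero_of_natDegree_lt hn, map_zero]).choose_spec n

theorem Polynomial.mapCoeff_monomial (φ : R →ₗ[ℚ] R) (n : ℕ) (a : R) :
    mapCoeff φ (monomial n a) = monomial n (φ a) := by
  ext m
  rw [coeff_mapCoeff, coeff_monomial, coeff_monomial, apply_ite φ, map_zero]

theorem Polynomial.eval_one_mapCoeff (φ : R →ₗ[ℚ] R) (p : R[X]) :
    (mapCoeff φ p).eval 1 = φ (p.eval 1) := by
  induction p using Polynomial.induction_on' with
  | add p q hp hq => simp only [map_add, eval_add, hp, hq]
  | monomial n a => simp [mapCoeff_monomial, eval_monomial]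

theorem Polynomial.derivative_mapCoeff (φ : R →ₗ[ℚ] R) (p : R[X]) :
    derivative (mapCoeff φ p) = mapCoeff φ (derivative p) := by
  ext n
  rw [coeff_derivative, coeff_mapCoeff, coeff_mapCoeff, coeff_derivative]
  have h : ∀ x : R, x * ((n : R) + 1) = (n + 1 : ℕ) • x := fun x => by
    rw [nsmul_eq_mul', Nat.cast_succ]
  rw [h, h, map_nsmul]

end Coeff

section Sign

open Polynomial

variable (B : CommDGA.{u})

theorem signTwist_mul (k : ℤ) (a b : B) :
    signTwist B.gr k (a * b) = signTwist B.gr k a * signTwist B.gr k b := by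
  induction a using DirectSum.Decomposition.inductionOn B.gr with
  | zero => simp
  | add x y hx hy => simp only [map_add, add_mul, hx, hy]
  | @homogeneous i a =>
    induction b using DirectSum.Decomposition.inductionOn B.gr with
    | zero => simp
    | add x y hx hy => simp only [map_add, mul_add, hx, hy]
    | @homogeneous j b =>
      rw [signTwist_apply _ _ _ a.2, signTwist_apply _ _ _ b.2,
        signTwist_apply _ _ _ (SetLike.mul_mem_graded a.2 b.2), smul_mul_smul_comm,
        ← zpow_add₀ (by norm_num), mul_add]

/-- Polynomials with coefficients of degree `i`. -/
def polyGr (i : ℤ) : Submodule ℚ B[X] where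
  carrier := {p | ∀ n, p.coeff n ∈ B.gr i}
  zero_mem' n := by simp
  add_mem' hp hq n := by rw [coeff_add]; exact add_mem (hp n) (hq n)
  smul_mem' r p hp n := by rw [coeff_smul]; exact Submodule.smul_mem _ _ (hp n)

variable {B}

theorem mul_mem_polyGr {i j : ℤ} {p q : B[X]} (hp : p ∈ polyGr B i) (hq : q ∈ polyGr B j) :
    p * q ∈ polyGr B (i + j) := fun n => by
  rw [coeff_mul]
  exact sum_mem fun x _ => SetLike.mul_mem_graded (hp _) (hq _)

theorem one_mem_polyGr : (1 : B[X]) ∈ polyGr B 0 := fun n => by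
  rw [coeff_one]
  split_ifs
  · exact SetLike.one_mem_graded B.gr
  · exact zero_mem _

theorem mapCoeff_d_mem_polyGr {i : ℤ} {p : B[X]} (hp : p ∈ polyGr B i) :
    mapCoeff B.d p ∈ polyGr B (i + 1) := fun n => by
  rw [coeff_mapCoeff]; exact B.d_mem _ _ (hp n)

theorem derivative_mem_polyGr {i : ℤ} {p : B[X]} (hp : p ∈ polyGr B i) :
    derivative p ∈ polyGr B i := fun n => by
  rw [coeff_derivative, ← Nat.cast_succ, ← nsmul_eq_mul']
  exact nsmul_mem (hp _) _

theorem polyGr_mul_comm {i j : ℤ} {p q : B[X]} (hp : p ∈ polyGr B i) (hq : q ∈ polyGr B j) :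
    p * q = ((-1 : ℚ) ^ (i * j)) • (q * p) := by
  ext n
  rw [coeff_smul, coeff_mul, coeff_mul, Finset.smul_sum, ← Finset.Nat.sum_antidiagonal_swap]
  exact Finset.sum_congr rfl fun x _ => B.mul_comm_graded i j _ _ (hp _) (hq _)

variable (B) in
/-- The sign automorphism `(-1)^deg` of `B[X]`. -/
noncomputable def polySign : B[X] →ₗ[ℚ] B[X] := mapCoeff (signTwist B.gr 1)

theorem polySign_of_mem {i : ℤ} {p : B[X]} (hp : p ∈ polyGr B i) :
    polySign B p = ((-1 : ℚ) ^ i) • p := by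
  ext n
  rw [polySign, coeff_mapCoeff, signTwist_apply _ _ _ (hp n), coeff_smul, one_mul]

theorem polySign_mul (p q : B[X]) : polySign B (p * q) = polySign B p * polySign B q := by
  ext n
  rw [polySign, coeff_mapCoeff, coeff_mul, coeff_mul, map_sum]
  exact Finset.sum_congr rfl fun x _ => by
    rw [coeff_mapCoeff, coeff_mapCoeff, signTwist_mul]

theorem polySign_one : polySign B 1 = 1 := by
  rw [polySign_of_mem one_mem_polyGr]; simp

theorem mapCoeff_d_mul {i : ℤ} {p : B[X]} (hp : p ∈ polyGr B i) (q : B[X]) :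
    mapCoeff B.d (p * q) = mapCoeff B.d p * q + ((-1 : ℚ) ^ i) • (p * mapCoeff B.d q) := by
  ext n
  rw [coeff_mapCoeff, coeff_add, coeff_smul, coeff_mul, coeff_mul, coeff_mul, map_sum,
    Finset.smul_sum, ← Finset.sum_add_distrib]
  exact Finset.sum_congr rfl fun x _ => by
    rw [coeff_mapCoeff, coeff_mapCoeff, B.leibniz i _ _ (hp _)]

end Sign

section Path

open Polynomial

/-- The algebra `B[t, dt]`; the pair of polynomials `(u, v)` stands for `u + dt · v`. -/
@[ext] structure PathAlg (B : CommDGA.{u}) : Type u where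
  fst : B[X]
  snd : B[X]

namespace PathAlg

variable (B : CommDGA.{u})

/-- `B[t, dt]` as the space of pairs of polynomials. -/
def equivProd : PathAlg B ≃ B[X] × B[X] where
  toFun x := (x.fst, x.snd)
  invFun x := ⟨x.fst, x.snd⟩

noncomputable instance : AddCommGroup (PathAlg B) := (equivProd B).addCommGroup

noncomputable instance : Module ℚ (PathAlg B) := (equivProd B).module ℚ

variable {B}

/-- As `u · dt = dt · (-1)^|u| u`, the product of `u + dt · v` and `u' + dt · v'` is
`u u' + dt · ((-1)^|u| u v' + v u')`. -/
noncomputable instance : Mul (PathAlg B) := 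
  ⟨fun x y => ⟨x.fst * y.fst, polySign B x.fst * y.snd + x.snd * y.fst⟩⟩

noncomputable instance : One (PathAlg B) := ⟨⟨1, 0⟩⟩

@[simp] theorem fst_mul (x y : PathAlg B) : (x * y).fst = x.fst * y.fst := rfl
@[simp] theorem snd_mul (x y : PathAlg B) :
    (x * y).snd = polySign B x.fst * y.snd + x.snd * y.fst := rfl
@[simp] theorem fst_one : (1 : PathAlg B).fst = 1 := rfl
@[simp] theorem snd_one : (1 : PathAlg B).snd = 0 := rfl
@[simp] theorem fst_zero : (0 : PathAlg B).fst = 0 := rfl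
@[simp] theorem snd_zero : (0 : PathAlg B).snd = 0 := rfl
@[simp] theorem fst_add (x y : PathAlg B) : (x + y).fst = x.fst + y.fst := rfl
@[simp] theorem snd_add (x y : PathAlg B) : (x + y).snd = x.snd + y.snd := rfl
@[simp] theorem fst_smul (r : ℚ) (x : PathAlg B) : (r • x).fst = r • x.fst := rfl
@[simp] theorem snd_smul (r : ℚ) (x : PathAlg B) : (r • x).snd = r • x.snd := rfl

noncomputable instance : Ring (PathAlg B) :=
  { (inferInstance : AddCommGroup (PathAlg B)), (inferInstance : Mul (PathAlg B)),
    (inferInstance : One (PathAlg B)) with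
    left_distrib := fun x y z => by
      ext1
      · simp [mul_add]
      · simp only [snd_mul, snd_add, fst_add, mul_add]; abel
    right_distrib := fun x y z => by
      ext1
      · simp [add_mul]
      · simp only [snd_mul, snd_add, fst_add, map_add, add_mul]; abel
    zero_mul := fun x => by ext1 <;> simp
    mul_zero := fun x => by ext1 <;> simp
    one_mul := fun x => by ext1 <;> simp [polySign_one]
    mul_one := fun x => by ext1 <;> simp
    mul_assoc := fun x y z => by
      ext1
      · simp [mul_assoc]
      · simp only [snd_mul, fst_mul, polySign_mul, mul_add, add_mul, mul_assoc, add_assoc] }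

noncomputable instance : Algebra ℚ (PathAlg B) :=
  Algebra.ofModule (fun r x y => by ext1 <;> simp [smul_add])
    (fun r x y => by ext1 <;> simp [smul_add])

variable (B)

/-- The degree `i` part `B^i[t] ⊕ dt B^(i-1)[t]`. -/
def gr (i : ℤ) : Submodule ℚ (PathAlg B) where
  carrier := {x | x.fst ∈ polyGr B i ∧ x.snd ∈ polyGr B (i - 1)}
  zero_mem' := ⟨zero_mem _, zero_mem _⟩
  add_mem' hx hy := ⟨add_mem hx.1 hy.1, add_mem hx.2 hy.2⟩
  smul_mem' r _ hx := ⟨Submodule.smul_mem _ r hx.1, Submodule.smul_mem _ r hx.2⟩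

/-- The differential `d (u + dt · v) = d u + dt (∂u/∂t - d v)`. -/
noncomputable def d : PathAlg B →ₗ[ℚ] PathAlg B where
  toFun x := ⟨mapCoeff B.d x.fst, derivative x.fst - mapCoeff B.d x.snd⟩
  map_add' x y := by
    ext1
    · exact map_add _ _ _
    · change derivative (x.fst + y.fst) - mapCoeff B.d (x.snd + y.snd) =
        (derivative x.fst - mapCoeff B.d x.snd) + (derivative y.fst - mapCoeff B.d y.snd)
      rw [map_add, map_add]; abel
  map_smul' r x := by
    ext1
    · exact map_smul _ _ _
    · change derivative (r • x.fst) - mapCoeff B.d (r • x.snd) =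
        r • (derivative x.fst - mapCoeff B.d x.snd)
      rw [derivative_smul, map_smul, smul_sub]

variable {B}

@[simp] theorem fst_d (x : PathAlg B) : (d B x).fst = mapCoeff B.d x.fst := rfl
@[simp] theorem snd_d (x : PathAlg B) : (d B x).snd = derivative x.fst - mapCoeff B.d x.snd := rfl

/-- The endomorphism of `B[t, dt]` given by a pair of endomorphisms of `B[t]`. -/
noncomputable def mapPair (φ ψ : B[X] →ₗ[ℚ] B[X]) : PathAlg B →ₗ[ℚ] PathAlg B where
  toFun x := ⟨φ x.fst, ψ x.snd⟩
  map_add' _ _ := PathAlg.ext (map_add φ _ _) (map_add ψ _ _)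
  map_smul' _ _ := PathAlg.ext (map_smul φ _ _) (map_smul ψ _ _)

instance : SetLike.GradedMonoid (gr B) where
  one_mem := ⟨one_mem_polyGr, zero_mem _⟩
  mul_mem i j x y hx hy := by
    refine ⟨mul_mem_polyGr hx.1 hy.1, ?_⟩
    rw [snd_mul, polySign_of_mem hx.1, smul_mul_assoc]
    refine add_mem (Submodule.smul_mem _ _ ?_) ?_
    · rw [show i + j - 1 = i + (j - 1) by ring]; exact mul_mem_polyGr hx.1 hy.2
    · rw [show i + j - 1 = i - 1 + j by ring]; exact mul_mem_polyGr hx.2 hy.1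

theorem isInternal_gr : DirectSum.IsInternal (gr B) := by
  have hmon : ∀ i n, ∀ b ∈ B.gr i, monomial n b ∈ polyGr B i := fun i n b hb m => by
    rw [coeff_monomial]
    split_ifs
    · exact hb
    · exact zero_mem _
  refine isInternal_of_proj (gr B)
    (fun i => mapPair (mapCoeff (grProj B.gr i)) (mapCoeff (grProj B.gr (i - 1))))
    (fun i x hx => ?_) (fun i j x hx hij => ?_) (fun x => ?_)
  · ext1
    · ext n; exact (coeff_mapCoeff _ _ _).trans (grProj_of_mem _ (hx.1 n))
    · ext n; exact (coeff_mapCoeff _ _ _).trans (grProj_of_mem _ (hx.2 n))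
  · ext1
    · ext n; exact (coeff_mapCoeff _ _ _).trans (grProj_of_mem_ne _ (hx.1 n) hij)
    · ext n; exact (coeff_mapCoeff _ _ _).trans (grProj_of_mem_ne _ (hx.2 n) (by omega))
  · have h₁ : ∀ u : B[X], (⟨u, 0⟩ : PathAlg B) ∈ ⨆ i, gr B i := fun u => by
      induction u using Polynomial.induction_on' with
      | add p q hp hq =>
        have : (⟨p + q, 0⟩ : PathAlg B) = ⟨p, 0⟩ + ⟨q, 0⟩ := by ext1 <;> simp
        rw [this]; exact add_mem hp hq
      | monomial n b =>
        induction b using DirectSum.Decomposition.inductionOn B.gr with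
        | zero => rw [map_zero]; exact zero_mem _
        | add a b ha hb =>
          have : (⟨monomial n (a + b), 0⟩ : PathAlg B) = ⟨monomial n a, 0⟩ + ⟨monomial n b, 0⟩ := by
            ext1 <;> simp
          rw [this]; exact add_mem ha hb
        | @homogeneous i b =>
          exact Submodule.mem_iSup_of_mem i ⟨hmon i n b b.2, zero_mem _⟩
    have h₂ : ∀ u : B[X], (⟨0, u⟩ : PathAlg B) ∈ ⨆ i, gr B i := fun u => by
      induction u using Polynomial.induction_on' with
      | add p q hp hq =>
        have : (⟨0, p + q⟩ : PathAlg B) = ⟨0, p⟩ + ⟨0, q⟩ := by ext1 <;> simp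
        rw [this]; exact add_mem hp hq
      | monomial n b =>
        induction b using DirectSum.Decomposition.inductionOn B.gr with
        | zero => rw [map_zero]; exact zero_mem _
        | add a b ha hb =>
          have : (⟨0, monomial n (a + b)⟩ : PathAlg B) = ⟨0, monomial n a⟩ + ⟨0, monomial n b⟩ := by
            ext1 <;> simp
          rw [this]; exact add_mem ha hb
        | @homogeneous i b =>
          refine Submodule.mem_iSup_of_mem (i + 1) ⟨zero_mem _, ?_⟩
          rw [add_sub_cancel_right]
          exact hmon i n b b.2
    have : x = (⟨x.fst, 0⟩ : PathAlg B) + ⟨0, x.snd⟩ := by ext1 <;> simp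
    rw [this]; exact add_mem (h₁ _) (h₂ _)

noncomputable instance : GradedAlgebra (gr B) :=
  { (inferInstance : SetLike.GradedMonoid (gr B)), isInternal_gr.chooseDecomposition with }

end PathAlg

namespace CommDGA

/-- The path object `B[t, dt]` of `B`, with `t` of degree `0` and `dt` of degree `1`. -/
noncomputable def path (B : CommDGA.{u}) : CommDGA.{u} where
  carrier := PathAlg B
  gr := PathAlg.gr B
  gr_neg i hi := by
    refine (Submodule.eq_bot_iff _).2 fun x hx => ?_
    ext n
    · simpa [B.gr_neg i hi] using hx.1 n
    · simpa [B.gr_neg (i - 1) (by omega)] using hx.2 n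
  mul_comm_graded i j x y hx hy := by
    ext1
    · exact polyGr_mul_comm hx.1 hy.1
    · simp only [PathAlg.snd_mul, PathAlg.snd_smul, polySign_of_mem hx.1, polySign_of_mem hy.1]
      rw [polyGr_mul_comm hx.2 hy.1, smul_mul_assoc, polyGr_mul_comm hx.1 hy.2, smul_mul_assoc,
        smul_add, smul_smul, smul_smul, ← zpow_add₀ (by norm_num), ← zpow_add₀ (by norm_num),
        add_comm, neg_one_zpow_eq (m := i + i * (j - 1)) (n := i * j) ⟨0, by ring⟩,
        neg_one_zpow_eq (m := (i - 1) * j) (n := i * j + j) ⟨-j, by ring⟩]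
  d := PathAlg.d B
  d_mem i x hx := by
    refine ⟨mapCoeff_d_mem_polyGr hx.1, sub_mem ?_ ?_⟩
    · rw [add_sub_cancel_right]; exact derivative_mem_polyGr hx.1
    · have := mapCoeff_d_mem_polyGr hx.2
      rwa [show i - 1 + 1 = i + 1 - 1 by ring] at this
  d_d x := by
    have h : ∀ p : B[X], mapCoeff B.d (mapCoeff B.d p) = 0 := fun p => by
      ext n; simp [B.d_d]
    ext1
    · exact h _
    · simp [derivative_mapCoeff, h]
  leibniz i x y hx := by
    ext1
    · exact mapCoeff_d_mul hx.1 _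
    · simp only [PathAlg.snd_mul, PathAlg.snd_smul, PathAlg.snd_d, PathAlg.snd_add, PathAlg.fst_mul,
        PathAlg.fst_d, polySign_of_mem hx.1, polySign_of_mem (mapCoeff_d_mem_polyGr hx.1),
        derivative_mul, map_add, smul_mul_assoc, map_smul, mapCoeff_d_mul hx.1,
        mapCoeff_d_mul hx.2, smul_add, smul_smul, mul_sub, sub_mul, smul_sub]
      rw [zpow_add₀ (by norm_num), zpow_sub₀ (by norm_num), ← mul_zpow]
      norm_num
      module

/-- Evaluation of `B[t, dt]` at `t = 0`. -/
noncomputable def evalZero (B : CommDGA.{u}) : CommDGA.Hom B.path B where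
  toAlgHom := AlgHom.ofLinearMap
    { toFun := fun x : PathAlg B => x.fst.coeff 0
      map_add' := fun _ _ => coeff_add _ _ _
      map_smul' := fun _ _ => coeff_smul _ _ _ }
    coeff_one_zero (fun _ _ => mul_coeff_zero _ _)
  map_gr _ _ hx := hx.1 0
  map_d _ := coeff_mapCoeff _ _ _

/-- Evaluation of `B[t, dt]` at `t = 1`. -/
noncomputable def evalOne (B : CommDGA.{u}) : CommDGA.Hom B.path B where
  toAlgHom := AlgHom.ofLinearMap
    { toFun := fun x : PathAlg B => x.fst.eval 1
      map_add' := fun _ _ => eval_add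
      map_smul' := fun _ _ => eval_smul _ _ _ }
    eval_one (fun _ _ => eval₂_mul_noncomm _ _ fun _ => Commute.one_right _)
  map_gr i x hx := by
    change x.fst.eval 1 ∈ B.gr i
    rw [eval_eq_sum]
    exact sum_mem fun n _ => by simpa using hx.1 n
  map_d _ := eval_one_mapCoeff _ _

section Pullback

variable {A : CommDGA.{u}} {B : CommDGA.{v}} {W : CommDGA.{w}} (f : CommDGA.Hom A B)
  (g : CommDGA.Hom W B)

/-- The subalgebra of pairs with the same image in `B`. -/
def pullbackAlg : Subalgebra ℚ (A × W) :=
  AlgHom.equalizer (f.toAlgHom.comp (AlgHom.fst ℚ A W)) (g.toAlgHom.comp (AlgHom.snd ℚ A W))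

variable {f g} in
theorem mem_pullbackAlg {x : A × W} :
    x ∈ pullbackAlg f g ↔ f.toAlgHom x.1 = g.toAlgHom x.2 := Iff.rfl

/-- The degree `i` part of the pullback: both components have degree `i`. -/
def pullbackGr (i : ℤ) : Submodule ℚ (pullbackAlg f g) where
  carrier := {x | x.1.1 ∈ A.gr i ∧ x.1.2 ∈ W.gr i}
  zero_mem' := ⟨zero_mem _, zero_mem _⟩
  add_mem' hx hy := ⟨add_mem hx.1 hy.1, add_mem hx.2 hy.2⟩
  smul_mem' r _ hx := ⟨Submodule.smul_mem _ r hx.1, Submodule.smul_mem _ r hx.2⟩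

/-- The endomorphism of the pullback given by endomorphisms of `A` and `W` that agree in `B`. -/
def pullbackMap (φ : A →ₗ[ℚ] A) (ψ : W →ₗ[ℚ] W)
    (h : ∀ x : pullbackAlg f g, f.toAlgHom (φ x.1.1) = g.toAlgHom (ψ x.1.2)) :
    pullbackAlg f g →ₗ[ℚ] pullbackAlg f g where
  toFun x := ⟨(φ x.1.1, ψ x.1.2), h x⟩
  map_add' _ _ := Subtype.ext (Prod.ext (map_add φ _ _) (map_add ψ _ _))
  map_smul' _ _ := Subtype.ext (Prod.ext (map_smul φ _ _) (map_smul ψ _ _))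

theorem isInternal_pullbackGr : DirectSum.IsInternal (pullbackGr f g) := by
  have hcompat : ∀ i, ∀ x : pullbackAlg f g,
      f.toAlgHom (grProj A.gr i x.1.1) = g.toAlgHom (grProj W.gr i x.1.2) := fun i x => by
    rw [← f.grProj_map, ← g.grProj_map, mem_pullbackAlg.1 x.2]
  refine isInternal_of_proj (pullbackGr f g)
    (fun i => pullbackMap f g (grProj A.gr i) (grProj W.gr i) (hcompat i))
    (fun i x hx => ?_) (fun i j x hx hij => ?_) (fun x => ?_)
  · exact Subtype.ext (Prod.ext (grProj_of_mem _ hx.1) (grProj_of_mem _ hx.2))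
  · exact Subtype.ext (Prod.ext (grProj_of_mem_ne _ hx.1 hij) (grProj_of_mem_ne _ hx.2 hij))
  · classical
    set s := (DirectSum.decompose A.gr x.1.1).support ∪ (DirectSum.decompose W.gr x.1.2).support
    have hx : x = ∑ i ∈ s, pullbackMap f g (grProj A.gr i) (grProj W.gr i) (hcompat i) x := by
      refine Subtype.ext (Prod.ext ?_ ?_)
      · rw [AddSubmonoidClass.coe_finsetSum, Prod.fst_sum]
        conv_lhs => rw [← DirectSum.sum_support_decompose A.gr x.1.1]
        refine Finset.sum_subset Finset.subset_union_left fun i _ hi => ?_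
        rw [DFinsupp.notMem_support_iff.1 hi]; rfl
      · rw [AddSubmonoidClass.coe_finsetSum, Prod.snd_sum]
        conv_lhs => rw [← DirectSum.sum_support_decompose W.gr x.1.2]
        refine Finset.sum_subset Finset.subset_union_right fun i _ hi => ?_
        rw [DFinsupp.notMem_support_iff.1 hi]; rfl
    rw [hx]
    exact sum_mem fun i _ => Submodule.mem_iSup_of_mem i ⟨grProj_mem _ _ _, grProj_mem _ _ _⟩

instance : SetLike.GradedMonoid (pullbackGr f g) where
  one_mem := ⟨SetLike.one_mem_graded A.gr, SetLike.one_mem_graded W.gr⟩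
  mul_mem _ _ _ _ hx hy := ⟨SetLike.mul_mem_graded hx.1 hy.1, SetLike.mul_mem_graded hx.2 hy.2⟩

noncomputable instance : GradedAlgebra (pullbackGr f g) :=
  { (inferInstance : SetLike.GradedMonoid (pullbackGr f g)),
    (isInternal_pullbackGr f g).chooseDecomposition with }

/-- The pullback of `A → B ← W` in the category of commutative DGAs. -/
noncomputable def pullback : CommDGA.{max u w} where
  carrier := pullbackAlg f g
  gr := pullbackGr f g
  gr_neg i hi := by
    refine (Submodule.eq_bot_iff _).2 fun x hx => ?_
    have h₁ := hx.1
    have h₂ := hx.2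
    rw [A.gr_neg i hi, Submodule.mem_bot] at h₁
    rw [W.gr_neg i hi, Submodule.mem_bot] at h₂
    exact Subtype.ext (Prod.ext h₁ h₂)
  mul_comm_graded i j x y hx hy := Subtype.ext (Prod.ext
    (A.mul_comm_graded i j _ _ hx.1 hy.1) (W.mul_comm_graded i j _ _ hx.2 hy.2))
  d := pullbackMap f g A.d W.d fun x => by rw [f.map_d, g.map_d, mem_pullbackAlg.1 x.2]
  d_mem i x hx := ⟨A.d_mem _ _ hx.1, W.d_mem _ _ hx.2⟩
  d_d x := Subtype.ext (Prod.ext (A.d_d _) (W.d_d _))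
  leibniz i x y hx := Subtype.ext (Prod.ext (A.leibniz i _ _ hx.1) (W.leibniz i _ _ hx.2))

/-- The projection of the pullback onto `A`. -/
noncomputable def pullbackFst : CommDGA.Hom (pullback f g) A where
  toAlgHom := (AlgHom.fst ℚ A W).comp (pullbackAlg f g).val
  map_gr _ _ hx := hx.1
  map_d _ := rfl

/-- The projection of the pullback onto `W`. -/
noncomputable def pullbackSnd : CommDGA.Hom (pullback f g) W where
  toAlgHom := (AlgHom.snd ℚ A W).comp (pullbackAlg f g).val
  map_gr _ _ hx := hx.2
  map_d _ := rfl

end Pullback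

end CommDGA

end Path

/-! ### The mapping path object -/

namespace CommDGA

open Polynomial

/-- Composition of morphisms. -/
def Hom.comp {A : CommDGA.{u}} {B : CommDGA.{v}} {C : CommDGA.{w}} (g : Hom B C) (f : Hom A B) :
    Hom A C where
  toAlgHom := g.toAlgHom.comp f.toAlgHom
  map_gr i a ha := g.map_gr i _ (f.map_gr i a ha)
  map_d a := by simp [f.map_d, g.map_d]

theorem cls_eq_cls_iff {A : CommDGA.{u}} {a b : A} (ha : A.d a = 0) (hb : A.d b = 0) :
    A.cls a ha = A.cls b hb ↔ ∃ y, A.d y = a - b :=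
  Submodule.Quotient.eq _

/-- For a cocycle `u + dt · v` of `B[t, dt]`, the primitive `V = ∫₀ᵗ v` satisfies `d V = u -
u(0)`. -/
theorem exists_primitive {B : CommDGA.{u}} (x : B.path) (hx : B.path.d x = 0) :
    ∃ V : B[X], V.coeff 0 = 0 ∧ derivative V = x.snd ∧
      mapCoeff B.d V = x.fst - C (x.fst.coeff 0) := by
  have h : ∀ n, B.d (x.snd.coeff n) = (n + 1 : ℚ) • x.fst.coeff (n + 1) := fun n => by
    have h := congrArg (fun y : PathAlg B => y.snd.coeff n) hx
    change (derivative x.fst - mapCoeff B.d x.snd).coeff n = 0 at h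
    rw [coeff_sub, coeff_mapCoeff, coeff_derivative, sub_eq_zero] at h
    rw [← h, ← Nat.cast_succ, ← nsmul_eq_mul', ← Nat.cast_succ, Nat.cast_smul_eq_nsmul]
  obtain ⟨V, hV⟩ := Polynomial.exists_coeff_eq
    (fun n => (n : ℚ)⁻¹ • x.snd.coeff (n - 1)) (x.snd.natDegree + 2) fun n hn => by
      rw [coeff_eq_zero_of_natDegree_lt (by omega), smul_zero]
  refine ⟨V, by simp [hV], ?_, ?_⟩
  · ext n
    rw [coeff_derivative, hV, ← Nat.cast_succ, ← nsmul_eq_mul', ← Nat.cast_smul_eq_nsmul ℚ,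
      smul_smul, mul_inv_cancel₀ (by positivity), one_smul, Nat.add_sub_cancel]
  · ext n
    rw [coeff_mapCoeff, hV, coeff_sub, coeff_C]
    cases n with
    | zero => simp
    | succ n =>
      rw [map_smul, Nat.add_sub_cancel, h, smul_smul, Nat.cast_succ,
        inv_mul_cancel₀ (by positivity)]
      simp

variable {A : CommDGA.{u}} {B : CommDGA.{v}} (f : Hom A B)

/-- The mapping path object of `f : A → B`: the pairs of `a ∈ A` and `u + dt · v ∈ B[t, dt]` with
`f a = u(0)`. -/
noncomputable abbrev mappingPath : CommDGA.{max u v} := pullback f (evalZero B)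

/-- The morphism to `B` that sends `(a, u + dt · v)` to the end point `u(1)`. -/
noncomputable def mappingPathEnd : Hom (mappingPath f) B :=
  (evalOne B).comp (pullbackSnd f (evalZero B))

theorem mappingPathEnd_apply (x : mappingPath f) :
    (mappingPathEnd f).toAlgHom x = x.1.2.fst.eval 1 := rfl

theorem mappingPath_start (x : mappingPath f) : f.toAlgHom x.1.1 = x.1.2.fst.coeff 0 := x.2

/-- The element `(a, u + dt · v)` of the mapping path object. -/
def mappingPathMk (a : A) (p q : B[X]) (h : f.toAlgHom a = p.coeff 0) : mappingPath f :=
  ⟨(a, (⟨p, q⟩ : PathAlg B)), h⟩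

theorem mappingPathEnd_mk (a : A) (p q : B[X]) (h : f.toAlgHom a = p.coeff 0) :
    (mappingPathEnd f).toAlgHom (mappingPathMk f a p q h) = p.eval 1 := rfl

theorem mappingPathEnd_surjective : Function.Surjective (mappingPathEnd f).toAlgHom := fun b =>
  ⟨mappingPathMk f 0 (X * C b) 0 (by simp), by rw [mappingPathEnd_mk]; simp [X_mul_C]⟩

/-- On a cocycle, the map `(a, u + dt · v) ↦ f a` and the end point map differ by a coboundary. -/
theorem exists_d_eq_end_sub (x : mappingPath f) (hx : (mappingPath f).d x = 0) :
    ∃ y, B.d y = f.toAlgHom x.1.1 - (mappingPathEnd f).toAlgHom x := by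
  obtain ⟨V, -, -, hV⟩ := exists_primitive x.1.2 (congrArg (fun y => y.1.2) hx)
  refine ⟨-V.eval 1, ?_⟩
  rw [map_neg, ← eval_one_mapCoeff, hV, mappingPathEnd_apply, mappingPath_start]
  simp

/-- If `f` is a quasi-isomorphism, the kernel of the end point map is acyclic. For a cocycle `(a,
u + dt · v)` with `u(1) = 0` and `V = ∫₀ᵗ v`, the class of `f a = -d V(1)` vanishes, so `a = d
a₀`; correcting `a₀` by a cocycle one gets `f a₀ + V(1) = d b`, and `(a₀, f a₀ + V - t d b - dt ·
b)` is a primitive in the kernel. -/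
theorem mappingPathEnd_ker_acyclic (hf : f.IsQuasiIso) (x : mappingPath f)
    (hx : (mappingPathEnd f).toAlgHom x = 0) (hdx : (mappingPath f).d x = 0) :
    ∃ y, (mappingPathEnd f).toAlgHom y = 0 ∧ (mappingPath f).d y = x := by
  obtain ⟨V, hV0, hV', hV⟩ := exists_primitive x.1.2 (congrArg (fun y => y.1.2) hdx)
  have hda : A.d x.1.1 = 0 := congrArg (fun y => y.1.1) hdx
  have hstart := mappingPath_start f x
  rw [mappingPathEnd_apply] at hx
  have hV1 : B.d (V.eval 1) = -f.toAlgHom x.1.1 := by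
    rw [← eval_one_mapCoeff, hV, hstart]
    simp [hx]
  obtain ⟨a', ha'⟩ : ∃ a', A.d a' = x.1.1 := by
    have : A.cls x.1.1 hda = A.cls 0 (map_zero _) := hf.1 <| by
      rw [MCProductData.mapCohomology_cls, MCProductData.mapCohomology_cls, cls_eq_cls_iff]
      exact ⟨-V.eval 1, by rw [map_neg, hV1, map_zero]; simp⟩
    simpa using (cls_eq_cls_iff _ _).1 this
  have hcocycle : B.d (f.toAlgHom a' + V.eval 1) = 0 := by
    rw [map_add, ← f.map_d, ha', hV1, add_neg_cancel]
  obtain ⟨a'', ha'', b, hb⟩ : ∃ a'', A.d a'' = 0 ∧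
      ∃ b, B.d b = f.toAlgHom a' + V.eval 1 - f.toAlgHom a'' := by
    obtain ⟨h, hh⟩ := hf.2 (B.cls _ hcocycle)
    obtain ⟨⟨a'', ha''⟩, rfl⟩ := Submodule.Quotient.mk_surjective _ h
    exact ⟨a'', ha'', (cls_eq_cls_iff _ (by
      rw [← f.map_d, LinearMap.mem_ker.1 ha'', map_zero])).1 hh.symm⟩
  refine ⟨mappingPathMk f (a' - a'') (C (f.toAlgHom (a' - a'')) + V - X * C (B.d b)) (-C b)
    (by simp [hV0]), ?_, Subtype.ext (Prod.ext ?_ (PathAlg.ext ?_ ?_))⟩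
  · rw [mappingPathEnd_mk, X_mul_C, eval_sub, eval_add, eval_C, eval_mul_X, eval_C, mul_one, hb,
      map_sub]
    abel
  · change A.d (a' - a'') = _
    rw [map_sub, ha', ha'', sub_zero]
  · change mapCoeff B.d (C (f.toAlgHom (a' - a'')) + V - X * C (B.d b)) = x.1.2.fst
    have h₁ : ∀ c : B, mapCoeff B.d (C c) = C (B.d c) := mapCoeff_monomial B.d 0
    have h₂ : mapCoeff B.d (X * C (B.d b)) = 0 := by
      rw [X_mul_C, C_mul_X_eq_monomial, mapCoeff_monomial, B.d_d, map_zero]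
    rw [map_sub, map_add, h₁, h₂, hV, ← f.map_d, map_sub, ha', ha'', sub_zero,
      sub_zero, hstart]
    abel
  · change derivative (C (f.toAlgHom (a' - a'')) + V - X * C (B.d b)) - mapCoeff B.d (-C b) =
      x.1.2.snd
    have h₁ : ∀ c : B, mapCoeff B.d (C c) = C (B.d c) := mapCoeff_monomial B.d 0
    rw [map_neg, h₁, map_sub, map_add, hV', derivative_C, X_mul_C, derivative_C_mul, derivative_X]
    simp

end CommDGA

theorem proposition3p1 (Λ : MCProductData.{u, v})
    (A : CommDGA.{w}) (B : CommDGA.{t}) (hA : A.IsConnected) (hB : B.IsConnected)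
    (f : CommDGA.Hom A B) (hf : f.IsQuasiIso) :
    Set.BijOn f.mapCohomology (Λ.MP A) (Λ.MP B) := by
  -- Injectivity is that of `f_*` on all of the cohomology; only surjectivity needs an argument.
  refine ⟨Λ.mapsTo_MP f, hf.1.injOn, fun h hh => ?_⟩
  obtain ⟨β, hβ, c, hc, hcurv, rfl⟩ := Λ.mem_MP_iff.1 hh
  obtain ⟨γ, hγ, e, he, rfl, hγe⟩ := Λ.exists_curvature_lift (CommDGA.mappingPathEnd f)
    (CommDGA.mappingPathEnd_surjective f) (CommDGA.mappingPathEnd_ker_acyclic f hf) hβ hcurv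
  have hmem := Λ.mapsTo_MP (CommDGA.pullbackFst f (CommDGA.evalZero B))
    (Λ.mem_MP_iff.2 ⟨γ, hγ, e, he, hγe, rfl⟩)
  refine ⟨_, hmem, ?_⟩
  rw [MCProductData.mapCohomology_cls, MCProductData.mapCohomology_cls, CommDGA.cls_eq_cls_iff]
  exact CommDGA.exists_d_eq_end_sub f e he
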